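/- Let $n,p\ge 1$ and $s\in\{1,\dots,p\}$ be integers, let $\sigma>0$ and $A\ge 2(4+\sqrt2)$, and let $\mathbb X\in\mathbb R^{n\times p}$. Write $\|u\|_n^2=\frac1n\sum_{i=1}^n u_i^2$ for $u\in\mathbb R^n$, write $|\cdot|_2$ for the Euclidean norm on $\mathbb R^p$, $|\beta|_0$ for the number of nonzero coordinates of $\beta\in\mathbb R^p$, and $\beta_1^\sharp\ge\dots\ge\beta_p^\sharp$ for the non-increasing rearrangement of $|\beta_1|,\dots,|\beta_p|$. Set $$\lambda_j=A\sigma\sqrt{\frac{\log(2p/j)}{n}}\quad(j=1,\dots,p),\qquad |\beta|_*=\sum_{j=1}^p\lambda_j\beta_j^\sharp,$$ and, for $c_0>0$, $$\mathcal C(s,c_0)=\Big\{\delta\in\mathbb R^p:\ |\delta|_*\le(1+c_0)\,|\delta|_2\Big(\sum_{j=1}^s\lambda_j^2\Big)^{1/2}\Big\},\qquad \vartheta(s,c_0)=\min_{\delta\in\mathcal C(s,c_0),\ \delta\ne0}\frac{\|\mathbb X\delta\|_n}{|\delta|_2}.$$ Assume the condition $WRE(s,7)$: every column of $\mathbb X$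 has $\|\cdot\|_n$-norm at most $1$, and $\vartheta(s,7)>0$. Let $f\in\mathbb R^n$, let $\mathbf y=f+\boldsymbol\xi$ with $\boldsymbol\xi\sim\mathcal N(0,\sigma^2I_{n\times n})$, and let $\hat\beta$ be the Slope estimator, that is, a random vector in $\mathbb R^p$ which almost surely satisfies $$\hat\beta\in\operatorname*{arg\,min}_{\beta\in\mathbb R^p}\big(\|\mathbb X\beta-\mathbf y\|_n^2+2|\beta|_*\big).$$ Then, for every $\beta\in\mathbb R^p$ with $|\beta|_0\le s$, $$\mathbb E\Big[\tfrac12|\hat\beta-\beta|_*+\|\mathbb X\hat\beta-f\|_n^2\Big]\le\|\mathbb X\beta-f\|_n^2+\frac{49\sum_{j=1}^s\lambda_j^2}{16}\Big(\frac1{\vartheta^2(s,7)}+\frac1{2\log(2p)}\Big).$$ Furthermore, if $f=\mathbb X\beta^*$ for some $\beta^*\in\mathbb R^p$ with $|\beta^*|_0\le s$, then $$\mathbb E\big[|\hat\beta-\beta^*|_2^2\big]\le\frac{9\sum_{j=1}^s\lambda_j^2}{4}\Big(\frac1{\vartheta^4(s,3)}+\frac1{(\log(2p))^2}\Big).$$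 Both expectations are finite. -/

import Mathlib

open MeasureTheory ProbabilityTheory

namespace Slope

noncomputable section

/-- The empirical norm `‖u‖_n` on `ℝⁿ`, given by `‖u‖_n² = (1/n) ∑ᵢ uᵢ²`. -/
def empNorm {n : ℕ} (u : EuclideanSpace ℝ (Fin n)) : ℝ :=
  Real.sqrt ((1 / (n : ℝ)) * ∑ i, u i ^ 2)

/-- The image `X β ∈ ℝⁿ` of `β ∈ ℝᵖ` under the design matrix. -/
def predict {n p : ℕ} (X : Matrix (Fin n) (Fin p) ℝ) (β : EuclideanSpace ℝ (Fin p)) :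
    EuclideanSpace ℝ (Fin n) :=
  Matrix.toEuclideanLin X β

/-- The number `|β|₀` of nonzero coordinates. -/
def l0 {p : ℕ} (β : EuclideanSpace ℝ (Fin p)) : ℕ :=
  Set.ncard {j | β j ≠ 0}

/-- The non-increasing rearrangement `β♯` of `(|β₁|, …, |βₚ|)`; the entry with index `j : Fin p`
is the `(j+1)`-st largest absolute value. `Tuple.sort g` is a permutation that makes `g` monotone,
here used for `g = -|β|`. -/
def rearr {p : ℕ} (β : EuclideanSpace ℝ (Fin p)) (j : Fin p) : ℝ :=
  |β (Tuple.sort (fun i => -|β i|) j)|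

theorem rearr_antitone {p : ℕ} (β : EuclideanSpace ℝ (Fin p)) : Antitone (rearr β) := by
  intro i j hij
  have h := Tuple.monotone_sort (fun i => -|β i|) hij
  simpa [rearr] using h

/-- The sorted `ℓ₁` norm `|β|_* = ∑ⱼ λⱼ β♯ⱼ` with weights `l = (λ₁, …, λₚ)`. -/
def starNorm {p : ℕ} (l : Fin p → ℝ) (β : EuclideanSpace ℝ (Fin p)) : ℝ :=
  ∑ j, l j * rearr β j

/-- `b` is a solution of the Slope minimization problem with weights `l` and observation `y`:
it minimizes `‖X β - y‖_n² + 2 |β|_*` over `β ∈ ℝᵖ`. -/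
def IsSlopeSolution {n p : ℕ} (X : Matrix (Fin n) (Fin p) ℝ) (l : Fin p → ℝ)
    (y : EuclideanSpace ℝ (Fin n)) (b : EuclideanSpace ℝ (Fin p)) : Prop :=
  ∀ β : EuclideanSpace ℝ (Fin p),
    empNorm (predict X b - y) ^ 2 + 2 * starNorm l b
      ≤ empNorm (predict X β - y) ^ 2 + 2 * starNorm l β

/-- The weights `λⱼ = A σ √(log(2p/j)/n)`, `j = 1, …, p`; the index `j : Fin p` stands for the
number `j + 1`. -/
def weights (n p : ℕ) (A σ : ℝ) (j : Fin p) : ℝ :=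
  A * σ * Real.sqrt (Real.log (2 * (p : ℝ) / ((j.val : ℝ) + 1)) / (n : ℝ))

/-- `∑_{j=1}^s λⱼ²`. -/
def sumSq {p : ℕ} (l : Fin p → ℝ) (s : ℕ) : ℝ :=
  ∑ j ∈ Finset.univ.filter (fun j : Fin p => j.val < s), l j ^ 2

/-- The cone of all `δ ∈ ℝᵖ` with `|δ|_* ≤ (1 + c₀) |δ|₂ √(∑_{j ≤ s} λⱼ²)`. -/
def wreCone {p : ℕ} (l : Fin p → ℝ) (s : ℕ) (c₀ : ℝ) : Set (EuclideanSpace ℝ (Fin p)) :=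
  {δ | starNorm l δ ≤ (1 + c₀) * ‖δ‖ * Real.sqrt (sumSq l s)}

/-- The weighted restricted eigenvalue `ϑ(s, c₀)`: the minimum (as an infimum) of `‖X δ‖_n / |δ|₂`
over the nonzero vectors `δ` of the cone. -/
def wreConst {n p : ℕ} (X : Matrix (Fin n) (Fin p) ℝ) (l : Fin p → ℝ) (s : ℕ) (c₀ : ℝ) : ℝ :=
  sInf {r | ∃ δ ∈ wreCone l s c₀, δ ≠ 0 ∧ r = empNorm (predict X δ) / ‖δ‖}

/-- The condition `WRE(s, c₀)`: the columns of `X` have empirical norm at most one, and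
`ϑ(s, c₀) > 0`. -/
def WRE {n p : ℕ} (X : Matrix (Fin n) (Fin p) ℝ) (l : Fin p → ℝ) (s : ℕ) (c₀ : ℝ) : Prop :=
  (∀ j : Fin p, empNorm (predict X (EuclideanSpace.single j 1)) ≤ 1) ∧ 0 < wreConst X l s c₀

end

end Slope

/-!
Both bounds are derived from a deterministic inequality on the noise `ξ`, which is then integrated.

*Noise.* Let `gₖ` be the normalized inner product of `ξ` with the `k`-th column of `X`, a centered
Gaussian variable of variance at most one, and let `K` be the closed convex set of noise vectors
with `∑ₖ exp(3 gₖ² / 8) ≤ 64 p` (`expSqSet`). On `K` all order statistics satisfy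
`gⱼ♯ ≤ 4 √(log (2p/j))` (`rearr_le_of_sum_exp_le`), so the noise term `⟪ξ, X u⟫ / n` is at most
`(4/A) |u|_*`. Markov's inequality gives `P(ξ ∉ K) ≤ 1/32`. In general `ξ` is an element of `K` plus
a displacement `v`, and the Cauchy–Schwarz inequality for `⟪v, X u⟫` yields `inner_predict_le_max`:
`2 ⟪ξ, X u⟫ / n ≤ max (|u|_*) (B ‖X u‖_n)` with `B² = A² ‖v‖² / (2n)`. This is where
`A ≥ 2 (4 + √2)` is used.

*Concentration.* What remains is a dimension-free control of `E ‖v‖²` and `E ‖v‖⁴`. The squared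
distance to `K` is convex with gradient `2 v`. Rotating `(ξ, ξ')` into `(ξ', -ξ)` in small steps, and
applying the gradient inequality at the end of each step, where the direction of motion is nearly an
independent copy of the position, gives `Var ‖v‖² ≤ π² σ² E ‖v‖²`
(`integral_sq_sub_sq_integral_le`). As `v` vanishes with probability at least `31/32`, this forces
`E ‖v‖² ≤ σ²` and `E ‖v‖⁴ ≤ 4 σ⁴` (`integral_sq_norm_le_and`).

*Oracle inequalities.* In the basic inequality (`IsSlopeSolution.basic_inequality`), if `|u|_*`
attains the maximum above, then sparsity (`exists_tail_of_l0_le`) either makes the right-hand side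
nonpositive or puts `u` in the cone, where the restricted eigenvalue applies. If `B ‖X u‖_n` attains
it, the error is bounded by `B` alone, together with `λ₁ |u|₂ ≤ |u|_*` (`mul_norm_le_starNorm`) for
the estimation error. The two cases produce the two summands of the final bounds.
-/

namespace Slope

/-! ### The sorted `ℓ₁` norm -/

lemma sum_mul_abs_comp_perm_le_starNorm {p : ℕ} {l : Fin p → ℝ} (hl : Antitone l)
    (β : EuclideanSpace ℝ (Fin p)) (π : Equiv.Perm (Fin p)) :
    ∑ j, l j * |β (π j)| ≤ starNorm l β := by
  have h : Monovary l (rearr β) := hl.monovary (rearr_antitone β)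
  have := h.sum_mul_comp_perm_le_sum_mul
    (σ := π.trans (Tuple.sort (fun i => -|β i|)).symm)
  simpa [starNorm, rearr] using this

/-- Entries taken along a permutation that sorts the absolute values are the rearrangement. -/
lemma starNorm_eq_of_antitone {p : ℕ} (l : Fin p → ℝ) (β : EuclideanSpace ℝ (Fin p))
    (π : Equiv.Perm (Fin p)) (h : Antitone fun j => |β (π j)|) :
    starNorm l β = ∑ j, l j * |β (π j)| := by
  have h1 : (fun i => -|β i|) ∘ π = (fun i => -|β i|) ∘ Tuple.sort (fun i => -|β i|) := by
    rw [Tuple.comp_sort_eq_comp_iff_monotone]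
    intro i j hij
    simpa using h hij
  refine Finset.sum_congr rfl fun j _ => ?_
  have h2 := congrFun h1 j
  simp only [Function.comp_apply, neg_inj] at h2
  rw [rearr, h2]

lemma starNorm_nonneg {p : ℕ} {l : Fin p → ℝ} (hl0 : ∀ j, 0 ≤ l j)
    (β : EuclideanSpace ℝ (Fin p)) : 0 ≤ starNorm l β :=
  Finset.sum_nonneg fun j _ => mul_nonneg (hl0 j) (abs_nonneg _)

lemma starNorm_add_le {p : ℕ} {l : Fin p → ℝ} (hl : Antitone l) (hl0 : ∀ j, 0 ≤ l j)
    (u v : EuclideanSpace ℝ (Fin p)) : starNorm l (u + v) ≤ starNorm l u + starNorm l v := by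
  set π := Tuple.sort (fun i => -|(u + v) i|) with hπ
  calc starNorm l (u + v) = ∑ j, l j * |(u + v) (π j)| := rfl
    _ ≤ ∑ j, (l j * |u (π j)| + l j * |v (π j)|) := by
        refine Finset.sum_le_sum fun j _ => ?_
        rw [← mul_add]
        exact mul_le_mul_of_nonneg_left (abs_add_le _ _) (hl0 j)
    _ ≤ _ := by
        rw [Finset.sum_add_distrib]
        exact add_le_add (sum_mul_abs_comp_perm_le_starNorm hl u π)
          (sum_mul_abs_comp_perm_le_starNorm hl v π)

lemma starNorm_smul_le {p : ℕ} {l : Fin p → ℝ} (hl : Antitone l) (c : ℝ)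
    (u : EuclideanSpace ℝ (Fin p)) : starNorm l (c • u) ≤ |c| * starNorm l u := by
  set π := Tuple.sort (fun i => -|(c • u) i|) with hπ
  calc starNorm l (c • u) = ∑ j, l j * |(c • u) (π j)| := rfl
    _ = |c| * ∑ j, l j * |u (π j)| := by
        rw [Finset.mul_sum]
        refine Finset.sum_congr rfl fun j _ => ?_
        simp only [PiLp.smul_apply, smul_eq_mul, abs_mul]
        ring
    _ ≤ _ := mul_le_mul_of_nonneg_left (sum_mul_abs_comp_perm_le_starNorm hl u π) (abs_nonneg c)

lemma starNorm_sub_starNorm_le {p : ℕ} {l : Fin p → ℝ} (hl : Antitone l) (hl0 : ∀ j, 0 ≤ l j)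
    (u v : EuclideanSpace ℝ (Fin p)) : starNorm l u - starNorm l v ≤ starNorm l (v - u) := by
  have h1 := starNorm_add_le hl hl0 v ((-1 : ℝ) • (v - u))
  have h2 := starNorm_smul_le hl (-1) (v - u)
  have e : v + (-1 : ℝ) • (v - u) = u := by module
  rw [e] at h1
  rw [abs_neg, abs_one, one_mul] at h2
  linarith

lemma continuous_starNorm {p : ℕ} {l : Fin p → ℝ} (hl : Antitone l) :
    Continuous (starNorm l) := by
  -- the sorted norm is a maximum of finitely many continuous functions, one per permutation
  have h : starNorm l = fun β => (Finset.univ : Finset (Equiv.Perm (Fin p))).sup'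
      Finset.univ_nonempty (fun π => ∑ j, l j * |β (π j)|) := by
    funext β
    refine le_antisymm ?_ (Finset.sup'_le _ _ fun π _ => sum_mul_abs_comp_perm_le_starNorm hl β π)
    exact Finset.le_sup' (fun π : Equiv.Perm (Fin p) => ∑ j, l j * |β (π j)|)
      (Finset.mem_univ (Tuple.sort (fun i => -|β i|)))
  rw [h]
  refine Continuous.finset_sup'_apply _ fun π _ => ?_
  fun_prop

/-- If `u` is sorted decreasingly along `π` on an upper set of positions, then at those positions
it dominates its decreasing rearrangement: otherwise the entries at positions `≥ j` along `π` and
the `j + 1` largest entries would be disjoint. -/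
lemma rearr_le_of_antitoneOn {p : ℕ} (u : EuclideanSpace ℝ (Fin p)) (π : Equiv.Perm (Fin p))
    (j : Fin p) (h : ∀ i, j ≤ i → |u (π i)| ≤ |u (π j)|) : rearr u j ≤ |u (π j)| := by
  by_contra! hlt
  set τ := Tuple.sort (fun i => -|u i|) with hτ
  have hdisj : Disjoint ((Finset.Ici j).map π.toEmbedding)
      ((Finset.Iic j).map τ.toEmbedding) := by
    rw [Finset.disjoint_left]
    rintro x hx hx'
    simp only [Finset.mem_map, Finset.mem_Ici, Finset.mem_Iic, Equiv.coe_toEmbedding] at hx hx'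
    obtain ⟨i, hi, rfl⟩ := hx
    obtain ⟨k, hk, hk'⟩ := hx'
    have h1 : rearr u j ≤ rearr u k := rearr_antitone u hk
    have h2 : rearr u k = |u (π i)| := by rw [← hk']; rfl
    linarith [h i hi]
  have hcard := Finset.card_le_univ
    (((Finset.Ici j).map π.toEmbedding).disjUnion ((Finset.Iic j).map τ.toEmbedding) hdisj)
  rw [Finset.card_disjUnion, Finset.card_map, Finset.card_map, Fin.card_Ici, Fin.card_Iic,
    Fintype.card_fin] at hcard
  have := j.2
  omega

lemma sum_mul_le_sqrt_sumSq_mul_norm {p : ℕ} (l : Fin p → ℝ) (s : ℕ)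
    (D : Finset (Fin p)) (hD : ∀ j ∈ D, j.val < s) (u : EuclideanSpace ℝ (Fin p))
    (π : Equiv.Perm (Fin p)) :
    ∑ j ∈ D, l j * |u (π j)| ≤ Real.sqrt (sumSq l s) * ‖u‖ := by
  have h1 := Real.sum_mul_le_sqrt_mul_sqrt D l (fun j => |u (π j)|)
  refine h1.trans ?_
  refine mul_le_mul (Real.sqrt_le_sqrt ?_) ?_ (Real.sqrt_nonneg _) (Real.sqrt_nonneg _)
  · refine Finset.sum_le_sum_of_subset_of_nonneg ?_ fun _ _ _ => sq_nonneg _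
    intro j hj
    simpa using hD j hj
  · rw [EuclideanSpace.norm_eq]
    refine Real.sqrt_le_sqrt ?_
    calc ∑ j ∈ D, |u (π j)| ^ 2 ≤ ∑ j, |u (π j)| ^ 2 :=
          Finset.sum_le_sum_of_subset_of_nonneg (Finset.subset_univ _) fun _ _ _ => sq_nonneg _
      _ = ∑ j, |u j| ^ 2 := Equiv.sum_comp π (fun j => |u j| ^ 2)
      _ = _ := by simp

/-- For an `s`-sparse `β`, moving from `β` to `β + u` increases the sorted norm by at least
`τ - Λ |u|₂`, while `|u|_* ≤ Λ |u|₂ + τ`, where `Λ² = ∑_{j ≤ s} λⱼ²`. Here `τ` is the part of the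
weighted sum that belongs to the coordinates outside the support of `β`, and the permutation used
lists the support first, sorted by `|β|`, then the remaining coordinates, sorted by `|u|`. -/
lemma exists_tail_of_l0_le {p : ℕ} {l : Fin p → ℝ} (hl : Antitone l) (hl0 : ∀ j, 0 ≤ l j)
    (s : ℕ) (β u : EuclideanSpace ℝ (Fin p)) (hβ : l0 β ≤ s) :
    ∃ τ : ℝ, starNorm l β - starNorm l (β + u) ≤ Real.sqrt (sumSq l s) * ‖u‖ - τ ∧
      starNorm l u ≤ Real.sqrt (sumSq l s) * ‖u‖ + τ := by
  classical
  set key : Fin p → ℝ ×ₗ ℝ := fun i => toLex (-|β i|, -|u i|) with hkey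
  set φ := Tuple.sort key with hφ
  have hmono : Monotone (key ∘ φ) := Tuple.monotone_sort key
  have hanti : Antitone fun j => |β (φ j)| := by
    intro i j hij
    have := Prod.Lex.monotone_fst _ _ (hmono hij)
    simpa [hkey] using this
  have hantiU : ∀ i j, i ≤ j → β (φ i) = 0 → |u (φ j)| ≤ |u (φ i)| := by
    intro i j hij hi
    have hj : β (φ j) = 0 := by
      have := hanti hij
      simp only [hi, abs_zero] at this
      exact abs_nonpos_iff.1 this
    have := hmono hij
    simp only [hkey, Function.comp_apply, Prod.Lex.le_iff, ofLex_toLex, hi, hj] at this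
    simpa using this
  set D : Finset (Fin p) := Finset.univ.filter fun j => β (φ j) ≠ 0 with hD
  have hDcard : D.card ≤ s := by
    refine le_trans (le_of_eq ?_) hβ
    rw [l0, Set.ncard_eq_toFinset_card', ← Finset.card_map φ.toEmbedding]
    congr 1
    ext i
    simp only [Finset.mem_map, hD, Finset.mem_filter, Finset.mem_univ, true_and,
      Equiv.coe_toEmbedding, Set.mem_toFinset, Set.mem_ofPred_eq]
    constructor
    · rintro ⟨j, hj, rfl⟩; exact hj
    · intro hi; exact ⟨φ.symm i, by simpa using hi, by simp⟩
  have hDlt : ∀ j ∈ D, j.val < s := by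
    intro j hj
    have hsub : Finset.Iic j ⊆ D := by
      intro i hi
      have h1 := hanti (Finset.mem_Iic.1 hi)
      simp only [hD, Finset.mem_filter, Finset.mem_univ, true_and] at hj ⊢
      have h2 : 0 < |β (φ j)| := abs_pos.2 hj
      exact abs_pos.1 (h2.trans_le h1)
    have := Finset.card_le_card hsub
    rw [Fin.card_Iic] at this
    omega
  have hsplit : ∀ g : Fin p → ℝ, ∑ j, g j = ∑ j ∈ D, g j + ∑ j ∈ Dᶜ, g j := fun g =>
    (Finset.sum_add_sum_compl D g).symm
  refine ⟨∑ j ∈ Dᶜ, l j * |u (φ j)|, ?_, ?_⟩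
  · have h1 := sum_mul_abs_comp_perm_le_starNorm hl (β + u) φ
    have h2 := sum_mul_le_sqrt_sumSq_mul_norm l s D hDlt u φ
    have h3 : starNorm l β = ∑ j ∈ D, l j * |β (φ j)| := by
      rw [starNorm_eq_of_antitone l β φ hanti, hsplit]
      simp only [add_eq_left]
      refine Finset.sum_eq_zero fun j hj => ?_
      have : β (φ j) = 0 := by simpa [hD] using hj
      simp [this]
    have h4 : ∑ j ∈ D, l j * |β (φ j)| - ∑ j ∈ D, l j * |u (φ j)|
        ≤ ∑ j ∈ D, l j * |(β + u) (φ j)| := by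
      rw [← Finset.sum_sub_distrib]
      refine Finset.sum_le_sum fun j _ => ?_
      rw [← mul_sub]
      refine mul_le_mul_of_nonneg_left ?_ (hl0 j)
      have := abs_sub_abs_le_abs_sub (β (φ j)) (-(u (φ j)))
      simpa using this
    have h5 : ∑ j ∈ Dᶜ, l j * |(β + u) (φ j)| = ∑ j ∈ Dᶜ, l j * |u (φ j)| := by
      refine Finset.sum_congr rfl fun j hj => ?_
      have : β (φ j) = 0 := by simpa [hD] using hj
      simp [this]
    rw [hsplit, h5] at h1
    linarith
  · have h2 := sum_mul_le_sqrt_sumSq_mul_norm l s D hDlt u (Tuple.sort fun i => -|u i|)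
    have h6 : starNorm l u = ∑ j ∈ D, l j * rearr u j + ∑ j ∈ Dᶜ, l j * rearr u j := hsplit _
    have h7 : ∑ j ∈ Dᶜ, l j * rearr u j ≤ ∑ j ∈ Dᶜ, l j * |u (φ j)| := by
      refine Finset.sum_le_sum fun j hj => mul_le_mul_of_nonneg_left ?_ (hl0 j)
      have hj0 : β (φ j) = 0 := by simpa [hD] using hj
      exact rearr_le_of_antitoneOn u φ j fun i hi => hantiU j i hi hj0
    have h8 : ∑ j ∈ D, l j * rearr u j ≤ Real.sqrt (sumSq l s) * ‖u‖ := h2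
    linarith

/-! ### Displacement to a closed convex set -/

open scoped RealInnerProductSpace in
/-- The displacement `w x = x - Πx` from the projection on a closed convex set. The last property
is the gradient inequality of the convex function `‖w‖²`, the squared distance to the set. -/
lemma exists_displacement {E : Type*} [NormedAddCommGroup E] [InnerProductSpace ℝ E]
    [CompleteSpace E] {K : Set E} (hne : K.Nonempty) (hc : IsClosed K) (hK : Convex ℝ K) :
    ∃ w : E → E, LipschitzWith 1 w ∧ (∀ x, x - w x ∈ K) ∧ (∀ x ∈ K, w x = 0) ∧
      ∀ x y, ‖w y‖ ^ 2 - ‖w x‖ ^ 2 ≤ 2 * ⟪w y, y - x⟫ := by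
  choose π hπK hπ using exists_norm_eq_iInf_of_complete_convex hne hc.isComplete hK
  have hchar : ∀ x, ∀ a ∈ K, ⟪x - π x, a - π x⟫ ≤ 0 := fun x =>
    (norm_eq_iInf_iff_real_inner_le_zero hK (hπK x)).1 (hπ x)
  refine ⟨fun x => x - π x, ?_, ?_, ?_, ?_⟩
  · refine LipschitzWith.of_dist_le_mul fun x y => ?_
    rw [dist_eq_norm, dist_eq_norm, NNReal.coe_one, one_mul]
    have h1 := hchar x _ (hπK y)
    have h2 := hchar y _ (hπK x)
    set d := (x - π x) - (y - π y) with hd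
    have h3 : ⟪d, x - y⟫ = ‖d‖ ^ 2 + ⟪d, π x - π y⟫ := by
      rw [← real_inner_self_eq_norm_sq, ← inner_add_right]
      congr 1
      rw [hd]; abel
    have h4 : 0 ≤ ⟪d, π x - π y⟫ := by
      have e1 : ⟪x - π x, π y - π x⟫ = -⟪x - π x, π x - π y⟫ := by
        rw [← inner_neg_right, neg_sub]
      rw [hd, inner_sub_left]
      linarith
    have h5 := real_inner_le_norm d (x - y)
    by_contra! hlt
    have : 0 ≤ ‖x - y‖ := norm_nonneg _
    nlinarith
  · intro x
    simpa using hπK x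
  · intro x hx
    have := hchar x x hx
    rw [real_inner_self_eq_norm_sq] at this
    have h0 : ‖x - π x‖ = 0 := by nlinarith [norm_nonneg (x - π x)]
    exact norm_eq_zero.1 h0
  · intro x y
    have h1 := hchar y _ (hπK x)
    have h2 : ⟪y - π y, y - x⟫
        = ‖y - π y‖ ^ 2 - ⟪y - π y, x - π x⟫ - ⟪y - π y, π x - π y⟫ := by
      rw [← real_inner_self_eq_norm_sq, ← inner_sub_right, ← inner_sub_right]
      congr 1
      abel
    have h3 := real_inner_le_norm (y - π y) (x - π x)
    simp only
    nlinarith [sq_nonneg (‖y - π y‖ - ‖x - π x‖)]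

/-! ### A Poincaré-type inequality for the squared distance -/

lemma norm_le_of_lipschitz {E : Type*} [NormedAddCommGroup E] {w : E → E}
    (hw : LipschitzWith 1 w) (x : E) : ‖w x‖ ≤ ‖w 0‖ + ‖x‖ := by
  have := hw.dist_le_mul x 0
  simp only [NNReal.coe_one, one_mul, dist_eq_norm, sub_zero] at this
  have h2 := norm_le_norm_add_norm_sub' (w x) (w 0)
  linarith

lemma sq_norm_mul_le {E : Type*} [NormedAddCommGroup E] {w : E → E}
    (hw : LipschitzWith 1 w) (x : E) (t : ℝ) :
    ‖w x‖ ^ 2 * t ^ 2 ≤ 5 * (1 + ‖w 0‖ ^ 4) * (1 + ‖x‖ ^ 4 + t ^ 4) := by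
  have h := norm_le_of_lipschitz hw x
  have h0 := norm_nonneg (w x)
  have h1 : ‖w x‖ ^ 2 ≤ 2 * ‖w 0‖ ^ 2 + 2 * ‖x‖ ^ 2 := by
    nlinarith [sq_nonneg (‖w 0‖ - ‖x‖), norm_nonneg (w 0), norm_nonneg x]
  have h2 : ‖w x‖ ^ 2 * t ^ 2 ≤ (2 * ‖w 0‖ ^ 2 + 2 * ‖x‖ ^ 2) * t ^ 2 :=
    mul_le_mul_of_nonneg_right h1 (sq_nonneg t)
  set a := ‖w 0‖ ^ 4 with ha
  have ha0 : 0 ≤ a := by positivity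
  have hx0 : 0 ≤ ‖x‖ ^ 4 := by positivity
  have ht0 : 0 ≤ t ^ 4 := by positivity
  have e1 : 2 * ‖w 0‖ ^ 2 * t ^ 2 ≤ a + t ^ 4 := by
    nlinarith [sq_nonneg (‖w 0‖ ^ 2 - t ^ 2)]
  have e2 : 2 * ‖x‖ ^ 2 * t ^ 2 ≤ ‖x‖ ^ 4 + t ^ 4 := by
    nlinarith [sq_nonneg (‖x‖ ^ 2 - t ^ 2)]
  nlinarith [mul_nonneg ha0 hx0, mul_nonneg ha0 ht0]

lemma sq_norm_le {E : Type*} [NormedAddCommGroup E] {w : E → E}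
    (hw : LipschitzWith 1 w) (x : E) :
    ‖w x‖ ^ 2 ≤ 10 * (1 + ‖w 0‖ ^ 4) * (1 + ‖x‖ ^ 4) := by
  have := sq_norm_mul_le hw x 1
  have h2 : 0 ≤ (1 + ‖w 0‖ ^ 4) * ‖x‖ ^ 4 := by positivity
  nlinarith

open scoped RealInnerProductSpace in
lemma sq_inner_le {E : Type*} [NormedAddCommGroup E] [InnerProductSpace ℝ E]
    (x y z : E) : ⟪x, y + z⟫ ^ 2 ≤ 2 * (‖x‖ ^ 2 * ‖y‖ ^ 2 + ‖x‖ ^ 2 * ‖z‖ ^ 2) := by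
  have h1 := abs_real_inner_le_norm x y
  have h2 := abs_real_inner_le_norm x z
  have h3 : ⟪x, y⟫ ^ 2 ≤ (‖x‖ * ‖y‖) ^ 2 := sq_le_sq' (abs_le.1 h1).1 (abs_le.1 h1).2
  have h4 : ⟪x, z⟫ ^ 2 ≤ (‖x‖ * ‖z‖) ^ 2 := sq_le_sq' (abs_le.1 h2).1 (abs_le.1 h2).2
  rw [inner_add_right]
  nlinarith [sq_nonneg (⟪x, y⟫ - ⟪x, z⟫)]

section Poincare

variable {E : Type*} [NormedAddCommGroup E] [InnerProductSpace ℝ E] [CompleteSpace E]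
  [SecondCountableTopology E] [MeasurableSpace E] [BorelSpace E]

lemma integrable_norm_pow_four (μ : Measure E) [IsGaussian μ] :
    Integrable (fun x => ‖x‖ ^ 4) μ := by
  have := (IsGaussian.memLp_id μ 4 (by norm_num)).integrable_norm_pow (by norm_num)
  simpa using this

lemma integrable_of_growth (μ : Measure E) [IsGaussian μ] {g : E → ℝ} (hg : Continuous g) (C : ℝ)
    (hC : ∀ x, |g x| ≤ C * (1 + ‖x‖ ^ 4)) : Integrable g μ := by
  refine Integrable.mono' (((integrable_const 1).add (integrable_norm_pow_four μ)).const_mul C)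
    hg.aestronglyMeasurable (Filter.Eventually.of_forall fun x => ?_)
  simpa using hC x

lemma integrable_prod_of_growth (μ : Measure E) [IsGaussian μ] {g : E × E → ℝ}
    (hg : Continuous g) (C : ℝ) (hC : ∀ z, |g z| ≤ C * (1 + ‖z.1‖ ^ 4 + ‖z.2‖ ^ 4)) :
    Integrable g (μ.prod μ) := by
  have h1 := (integrable_norm_pow_four μ).comp_fst μ
  have h2 := (integrable_norm_pow_four μ).comp_snd μ
  refine Integrable.mono' ((((integrable_const 1).add h1).add h2).const_mul C)
    hg.aestronglyMeasurable (Filter.Eventually.of_forall fun x => ?_)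
  simpa using hC x

variable {w : E → E}

lemma integrable_sq_norm (μ : Measure E) [IsGaussian μ] (hw : LipschitzWith 1 w) :
    Integrable (fun x => ‖w x‖ ^ 2) μ := by
  refine integrable_of_growth μ (hw.continuous.norm.pow 2) (10 * (1 + ‖w 0‖ ^ 4)) fun x => ?_
  rw [abs_of_nonneg (by positivity)]
  exact sq_norm_le hw x

lemma integrable_sq_sq_norm (μ : Measure E) [IsGaussian μ] (hw : LipschitzWith 1 w) :
    Integrable (fun x => (‖w x‖ ^ 2) ^ 2) μ := by
  refine integrable_of_growth μ ((hw.continuous.norm.pow 2).pow 2) (8 * (1 + ‖w 0‖ ^ 4))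
    fun x => ?_
  rw [abs_of_nonneg (by positivity)]
  have h := norm_le_of_lipschitz hw x
  have h0 := norm_nonneg (w x)
  have h1 : ‖w x‖ ^ 2 ≤ 2 * ‖w 0‖ ^ 2 + 2 * ‖x‖ ^ 2 := by
    nlinarith [sq_nonneg (‖w 0‖ - ‖x‖), norm_nonneg (w 0), norm_nonneg x]
  have h2 : (‖w x‖ ^ 2) ^ 2 ≤ (2 * ‖w 0‖ ^ 2 + 2 * ‖x‖ ^ 2) ^ 2 :=
    pow_le_pow_left₀ (by positivity) h1 2
  have h3 : 0 ≤ ‖w 0‖ ^ 4 * ‖x‖ ^ 4 := by positivity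
  nlinarith [sq_nonneg (‖w 0‖ ^ 2 - ‖x‖ ^ 2)]

open scoped RealInnerProductSpace

lemma integrable_increment_sq (μ : Measure E) [IsGaussian μ] (hw : LipschitzWith 1 w) (α β : ℝ) :
    Integrable (fun z : E × E => (2 * ⟪w z.1, α • z.1 + β • z.2⟫) ^ 2) (μ.prod μ) := by
  have hwc := hw.continuous
  refine integrable_prod_of_growth μ (by fun_prop)
    (80 * (α ^ 2 + β ^ 2) * (1 + ‖w 0‖ ^ 4)) fun z => ?_
  rw [abs_of_nonneg (by positivity)]
  have h1 := sq_inner_le (w z.1) (α • z.1) (β • z.2)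
  have h2 := sq_norm_mul_le hw z.1 ‖z.1‖
  have h3 := sq_norm_mul_le hw z.1 ‖z.2‖
  rw [norm_smul, norm_smul, mul_pow, mul_pow, Real.norm_eq_abs, Real.norm_eq_abs, sq_abs,
    sq_abs] at h1
  set M := 5 * (1 + ‖w 0‖ ^ 4) with hM
  have hM0 : 0 ≤ M := by positivity
  have h5 : 0 ≤ ‖z.2‖ ^ 4 := by positivity
  have h2' : ‖w z.1‖ ^ 2 * ‖z.1‖ ^ 2 ≤ 2 * M * (1 + ‖z.1‖ ^ 4 + ‖z.2‖ ^ 4) := by nlinarith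
  have h3' : ‖w z.1‖ ^ 2 * ‖z.2‖ ^ 2 ≤ 2 * M * (1 + ‖z.1‖ ^ 4 + ‖z.2‖ ^ 4) :=
    h3.trans (by have h6 : 0 ≤ ‖z.1‖ ^ 4 := by positivity
                 nlinarith)
  have e2 := mul_le_mul_of_nonneg_left h2' (sq_nonneg α)
  have e3 := mul_le_mul_of_nonneg_left h3' (sq_nonneg β)
  calc (2 * ⟪w z.1, α • z.1 + β • z.2⟫) ^ 2 = 4 * ⟪w z.1, α • z.1 + β • z.2⟫ ^ 2 := by ring
    _ ≤ 8 * (α ^ 2 * (‖w z.1‖ ^ 2 * ‖z.1‖ ^ 2) + β ^ 2 * (‖w z.1‖ ^ 2 * ‖z.2‖ ^ 2)) := by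
        linarith
    _ ≤ 8 * ((α ^ 2 + β ^ 2) * (2 * M * (1 + ‖z.1‖ ^ 4 + ‖z.2‖ ^ 4))) := by linarith
    _ = _ := by rw [hM]; ring

/-- The second moment of a single rotation increment. Given the first coordinate, the second one
is independent and centered, so the two contributions are orthogonal. -/
lemma integral_increment_sq_le (μ : Measure E) [IsGaussian μ] (hμ : μ[id] = 0) {c : ℝ}
    (hvar : ∀ v : E, ∫ x, ⟪v, x⟫ ^ 2 ∂μ ≤ c * ‖v‖ ^ 2) (hw : LipschitzWith 1 w) (α β : ℝ) :
    ∫ z, (2 * ⟪w z.1, α • z.1 + β • z.2⟫) ^ 2 ∂(μ.prod μ)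
      ≤ 4 * α ^ 2 * ∫ x, ⟪w x, x⟫ ^ 2 ∂μ + 4 * β ^ 2 * (c * ∫ x, ‖w x‖ ^ 2 ∂μ) := by
  have hint := integrable_increment_sq μ hw α β
  have hwc := hw.continuous
  have hP : Integrable (fun x => ⟪w x, x⟫ ^ 2) μ := by
    refine integrable_of_growth μ (by fun_prop) (10 * (1 + ‖w 0‖ ^ 4)) fun x => ?_
    rw [abs_of_nonneg (by positivity)]
    have h2 := sq_norm_mul_le hw x ‖x‖
    have h3 := abs_real_inner_le_norm (w x) x
    have h4 : ⟪w x, x⟫ ^ 2 ≤ (‖w x‖ * ‖x‖) ^ 2 := sq_le_sq' (abs_le.1 h3).1 (abs_le.1 h3).2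
    have h5 : 0 ≤ 1 + ‖w 0‖ ^ 4 := by positivity
    nlinarith
  have hF := integrable_sq_norm μ hw
  rw [integral_prod _ hint, ← integral_const_mul, ← integral_const_mul, ← integral_const_mul,
    ← integral_add (hP.const_mul _) ((hF.const_mul _).const_mul _)]
  refine integral_mono hint.integral_prod_left ((hP.const_mul _).add
    ((hF.const_mul _).const_mul _)) fun x => ?_
  have hlin : Integrable (fun y => ⟪w x, y⟫) μ :=
    (IsGaussian.integrable_id (μ := μ)).const_inner (w x)
  have hlin0 : ∫ y, ⟪w x, y⟫ ∂μ = 0 := by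
    rw [integral_inner IsGaussian.integrable_fun_id]
    have : ∫ y, y ∂μ = 0 := hμ
    rw [this, inner_zero_right]
  have hsq : Integrable (fun y => ⟪w x, y⟫ ^ 2) μ := by
    have := ((IsGaussian.memLp_two_id (μ := μ)).const_inner (w x)).integrable_sq
    simpa using this
  calc ∫ y, (2 * ⟪w x, α • x + β • y⟫) ^ 2 ∂μ
      = ∫ y, (4 * α ^ 2 * ⟪w x, x⟫ ^ 2 + (8 * α * β * ⟪w x, x⟫) * ⟪w x, y⟫
          + 4 * β ^ 2 * ⟪w x, y⟫ ^ 2) ∂μ := by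
        refine integral_congr_ae (Filter.Eventually.of_forall fun y => ?_)
        simp only [inner_add_right, inner_smul_right]
        ring
    _ = 4 * α ^ 2 * ⟪w x, x⟫ ^ 2 + 4 * β ^ 2 * ∫ y, ⟪w x, y⟫ ^ 2 ∂μ := by
        have hi : Integrable (fun y => 4 * α ^ 2 * ⟪w x, x⟫ ^ 2
            + (8 * α * β * ⟪w x, x⟫) * ⟪w x, y⟫) μ := (integrable_const _).add (hlin.const_mul _)
        rw [integral_add hi (hsq.const_mul _),
          integral_add (integrable_const _) (hlin.const_mul _), integral_const,
          integral_const_mul, integral_const_mul, hlin0]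
        simp
    _ ≤ _ := by
        have := mul_le_mul_of_nonneg_left (hvar (w x)) (by positivity : 0 ≤ 4 * β ^ 2)
        simpa using this

/-- The rotation from one copy to an independent one is cut into `N` equal steps. Each step is
bounded by the gradient inequality at its endpoint, and all endpoints have the same law. -/
lemma integral_sq_posPart_le_div (μ : Measure E) [IsGaussian μ] (hμ : μ[id] = 0) {c : ℝ}
    (hc : 0 ≤ c) (hvar : ∀ v : E, ∫ x, ⟪v, x⟫ ^ 2 ∂μ ≤ c * ‖v‖ ^ 2) (hw : LipschitzWith 1 w)
    (hgrad : ∀ x y, ‖w y‖ ^ 2 - ‖w x‖ ^ 2 ≤ 2 * ⟪w y, y - x⟫) (N : ℕ) (hN : N ≠ 0) :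
    ∫ z, (max (‖w z.2‖ ^ 2 - ‖w z.1‖ ^ 2) 0) ^ 2 ∂(μ.prod μ)
      ≤ Real.pi ^ 4 / 16 * (∫ x, ⟪w x, x⟫ ^ 2 ∂μ) / (N : ℝ) ^ 2
        + Real.pi ^ 2 * c * ∫ x, ‖w x‖ ^ 2 ∂μ := by
  have hN' : (N : ℝ) ≠ 0 := Nat.cast_ne_zero.2 hN
  set h : ℝ := Real.pi / 2 / N with hh
  have hNh : (N : ℝ) * h = Real.pi / 2 := by rw [hh]; field_simp
  have hh0 : 0 ≤ h := by positivity
  set b : E × E → ℝ := fun z => 2 * ⟪w z.1, (1 - Real.cos h) • z.1 + Real.sin h • z.2⟫ with hb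
  set R : ℕ → E × E → E × E := fun k => ContinuousLinearMap.rotation (k * h) with hR
  have hbint : Integrable (fun z => b z ^ 2) (μ.prod μ) := integrable_increment_sq μ hw _ _
  have hRmp : ∀ k, MeasurePreserving (R k) (μ.prod μ) (μ.prod μ) := fun k =>
    ⟨(ContinuousLinearMap.rotation (k * h) : E × E →L[ℝ] E × E).continuous.measurable,
      IsGaussian.map_rotation_eq_self hμ _⟩
  have hstep : ∀ z k, ‖w (R (k + 1) z).1‖ ^ 2 - ‖w (R k z).1‖ ^ 2 ≤ b (R (k + 1) z) := by
    intro z k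
    refine (hgrad _ _).trans (le_of_eq ?_)
    simp only [hb, hR]
    congr 2
    simp only [ContinuousLinearMap.rotation_apply, Nat.cast_add, Nat.cast_one]
    have e1 : (k : ℝ) * h = (k + 1) * h - h := by ring
    have e2 : Real.cos (k * h) = Real.cos ((k + 1) * h) * Real.cos h
        + Real.sin ((k + 1) * h) * Real.sin h := by rw [e1, Real.cos_sub]
    have e3 : Real.sin (k * h) = Real.sin ((k + 1) * h) * Real.cos h
        - Real.cos ((k + 1) * h) * Real.sin h := by rw [e1, Real.sin_sub]
    rw [e2, e3]
    module
  have htel : ∀ z, ‖w z.2‖ ^ 2 - ‖w z.1‖ ^ 2 ≤ ∑ k ∈ Finset.range N, b (R (k + 1) z) := by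
    intro z
    have h1 := Finset.sum_range_sub (fun k => ‖w (R k z).1‖ ^ 2) N
    have h2 : (R N z).1 = z.2 := by
      simp [hR, ContinuousLinearMap.rotation_apply, hNh]
    have h3 : (R 0 z).1 = z.1 := by
      simp [hR, ContinuousLinearMap.rotation_apply]
    rw [h2, h3] at h1
    rw [← h1]
    exact Finset.sum_le_sum fun k _ => hstep z k
  have hsq : ∀ z, (max (‖w z.2‖ ^ 2 - ‖w z.1‖ ^ 2) 0) ^ 2
      ≤ N * ∑ k ∈ Finset.range N, b (R (k + 1) z) ^ 2 := by
    intro z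
    have h1 := sq_sum_le_card_mul_sum_sq (s := Finset.range N) (f := fun k => b (R (k + 1) z))
    rw [Finset.card_range] at h1
    refine le_trans ?_ h1
    refine sq_le_sq.2 ?_
    rw [abs_of_nonneg (le_max_right _ _)]
    exact max_le ((htel z).trans (le_abs_self _)) (abs_nonneg _)
  have hbR : ∀ k, Integrable (fun z => b (R k z) ^ 2) (μ.prod μ) := fun k =>
    (hRmp k).integrable_comp_of_integrable hbint
  have hbRi : ∀ k, ∫ z, b (R k z) ^ 2 ∂(μ.prod μ) = ∫ z, b z ^ 2 ∂(μ.prod μ) := by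
    intro k
    have h1 : AEStronglyMeasurable (fun z => b z ^ 2) ((μ.prod μ).map (R k)) := by
      rw [(hRmp k).map_eq]; exact hbint.aestronglyMeasurable
    have h2 := integral_map (hRmp k).measurable.aemeasurable h1
    rw [(hRmp k).map_eq] at h2
    exact h2.symm
  have hsum : ∫ z, (max (‖w z.2‖ ^ 2 - ‖w z.1‖ ^ 2) 0) ^ 2 ∂(μ.prod μ)
      ≤ (N : ℝ) ^ 2 * ∫ z, b z ^ 2 ∂(μ.prod μ) := by
    calc ∫ z, (max (‖w z.2‖ ^ 2 - ‖w z.1‖ ^ 2) 0) ^ 2 ∂(μ.prod μ)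
        ≤ ∫ z, N * ∑ k ∈ Finset.range N, b (R (k + 1) z) ^ 2 ∂(μ.prod μ) :=
          integral_mono_of_nonneg (Filter.Eventually.of_forall fun z => sq_nonneg _)
            ((integrable_finsetSum _ fun k _ => hbR (k + 1)).const_mul _)
            (Filter.Eventually.of_forall hsq)
      _ = _ := by
          rw [integral_const_mul, integral_finsetSum _ fun k _ => hbR (k + 1)]
          simp only [hbRi, Finset.sum_const, Finset.card_range, nsmul_eq_mul]
          ring
  refine hsum.trans ?_
  have hb2 := integral_increment_sq_le μ hμ hvar hw (1 - Real.cos h) (Real.sin h)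
  set K := ∫ x, ⟪w x, x⟫ ^ 2 ∂μ with hK
  set m := ∫ x, ‖w x‖ ^ 2 ∂μ with hm
  have hK0 : 0 ≤ K := integral_nonneg fun x => sq_nonneg _
  have hm0 : 0 ≤ m := integral_nonneg fun x => sq_nonneg _
  have hα : (1 - Real.cos h) ^ 2 ≤ (h ^ 2 / 2) ^ 2 := by
    refine pow_le_pow_left₀ (by linarith [Real.cos_le_one h]) ?_ 2
    linarith [Real.one_sub_sq_div_two_le_cos (x := h)]
  have hβ : Real.sin h ^ 2 ≤ h ^ 2 := by
    refine sq_le_sq.2 ?_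
    exact Real.abs_sin_le_abs
  calc (N : ℝ) ^ 2 * ∫ z, b z ^ 2 ∂(μ.prod μ)
      ≤ (N : ℝ) ^ 2 * (4 * (h ^ 2 / 2) ^ 2 * K + 4 * h ^ 2 * (c * m)) := by
        refine mul_le_mul_of_nonneg_left (hb2.trans ?_) (by positivity)
        gcongr
    _ = _ := by
        rw [hh]
        field_simp
        ring

/-- A Poincaré-type inequality: the variance of `‖w‖²` under a centered Gaussian measure with
covariance at most `c` is at most `π² c E‖w‖²`. -/
lemma integral_sq_sub_sq_integral_le (μ : Measure E) [IsGaussian μ] (hμ : μ[id] = 0) {c : ℝ}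
    (hc : 0 ≤ c) (hvar : ∀ v : E, ∫ x, ⟪v, x⟫ ^ 2 ∂μ ≤ c * ‖v‖ ^ 2) (hw : LipschitzWith 1 w)
    (hgrad : ∀ x y, ‖w y‖ ^ 2 - ‖w x‖ ^ 2 ≤ 2 * ⟪w y, y - x⟫) :
    ∫ x, (‖w x‖ ^ 2) ^ 2 ∂μ - (∫ x, ‖w x‖ ^ 2 ∂μ) ^ 2
      ≤ Real.pi ^ 2 * c * ∫ x, ‖w x‖ ^ 2 ∂μ := by
  set F : E → ℝ := fun x => ‖w x‖ ^ 2 with hF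
  have hF1 : Integrable F μ := integrable_sq_norm μ hw
  have hF2 : Integrable (fun x => F x ^ 2) μ := integrable_sq_sq_norm μ hw
  have hFc : Continuous F := hw.continuous.norm.pow 2
  have hlim : ∫ z, (max (F z.2 - F z.1) 0) ^ 2 ∂(μ.prod μ) ≤ Real.pi ^ 2 * c * ∫ x, F x ∂μ := by
    have ht : Filter.Tendsto (fun N : ℕ => Real.pi ^ 4 / 16 * (∫ x, ⟪w x, x⟫ ^ 2 ∂μ) / (N : ℝ) ^ 2
        + Real.pi ^ 2 * c * ∫ x, F x ∂μ) Filter.atTop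
        (nhds (0 + Real.pi ^ 2 * c * ∫ x, F x ∂μ)) := by
      refine Filter.Tendsto.add_const _ ?_
      refine Filter.Tendsto.div_atTop tendsto_const_nhds ?_
      exact (Filter.tendsto_pow_atTop two_ne_zero).comp tendsto_natCast_atTop_atTop
    rw [zero_add] at ht
    refine ge_of_tendsto ht ?_
    filter_upwards [Filter.eventually_ne_atTop 0] with N hN
    exact integral_sq_posPart_le_div μ hμ hc hvar hw hgrad N hN
  have hi1 : Integrable (fun z : E × E => F z.1 ^ 2) (μ.prod μ) := hF2.comp_fst μ
  have hi2 : Integrable (fun z : E × E => F z.2 ^ 2) (μ.prod μ) := hF2.comp_snd μ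
  have hi3 : Integrable (fun z : E × E => F z.1 * F z.2) (μ.prod μ) := hF1.mul_prod hF1
  have hall : ∫ z, (F z.2 - F z.1) ^ 2 ∂(μ.prod μ)
      = 2 * (∫ x, F x ^ 2 ∂μ - (∫ x, F x ∂μ) ^ 2) := by
    calc ∫ z, (F z.2 - F z.1) ^ 2 ∂(μ.prod μ)
        = ∫ z, (F z.1 ^ 2 + F z.2 ^ 2 - 2 * (F z.1 * F z.2)) ∂(μ.prod μ) := by
          refine integral_congr_ae (Filter.Eventually.of_forall fun z => ?_)
          simp only
          ring
      _ = _ := by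
          have hi : Integrable (fun z : E × E => F z.1 ^ 2 + F z.2 ^ 2) (μ.prod μ) := hi1.add hi2
          rw [integral_sub hi (hi3.const_mul 2), integral_add hi1 hi2,
            integral_const_mul, integral_prod_mul,
            integral_fun_fst (fun x => F x ^ 2), integral_fun_snd (fun x => F x ^ 2)]
          simp
          ring
  have hdom : Integrable (fun z : E × E => F z.1 ^ 2 + F z.2 ^ 2) (μ.prod μ) := hi1.add hi2
  have hF0 : ∀ x, 0 ≤ F x := fun x => sq_nonneg _
  have hmax : ∀ a b : ℝ, 0 ≤ a → 0 ≤ b → (max (a - b) 0) ^ 2 ≤ b ^ 2 + a ^ 2 := by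
    intro a b ha hb
    rcases le_total (a - b) 0 with h | h
    · rw [max_eq_right h]; nlinarith
    · rw [max_eq_left h]; nlinarith [mul_nonneg ha hb]
  have hp1 : Integrable (fun z : E × E => (max (F z.2 - F z.1) 0) ^ 2) (μ.prod μ) := by
    refine hdom.mono' (by fun_prop) (Filter.Eventually.of_forall fun z => ?_)
    rw [Real.norm_eq_abs, abs_of_nonneg (sq_nonneg _)]
    exact hmax _ _ (hF0 _) (hF0 _)
  have hp2 : Integrable (fun z : E × E => (max (F z.1 - F z.2) 0) ^ 2) (μ.prod μ) := hp1.swap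
  have hswap : ∫ z, (max (F z.1 - F z.2) 0) ^ 2 ∂(μ.prod μ)
      = ∫ z, (max (F z.2 - F z.1) 0) ^ 2 ∂(μ.prod μ) :=
    integral_prod_swap (μ := μ) (ν := μ) (fun z : E × E => (max (F z.2 - F z.1) 0) ^ 2)
  have hsplit : ∫ z, (F z.2 - F z.1) ^ 2 ∂(μ.prod μ)
      = ∫ z, (max (F z.2 - F z.1) 0) ^ 2 ∂(μ.prod μ)
        + ∫ z, (max (F z.1 - F z.2) 0) ^ 2 ∂(μ.prod μ) := by
    rw [← integral_add hp1 hp2]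
    refine integral_congr_ae (Filter.Eventually.of_forall fun z => ?_)
    simp only
    rcases le_total (F z.1) (F z.2) with h | h
    · rw [max_eq_left (by linarith : 0 ≤ F z.2 - F z.1),
        max_eq_right (by linarith : F z.1 - F z.2 ≤ 0)]; ring
    · rw [max_eq_right (by linarith : F z.2 - F z.1 ≤ 0),
        max_eq_left (by linarith : 0 ≤ F z.1 - F z.2)]; ring
  rw [hsplit, hswap] at hall
  linarith

/-- If `w` vanishes outside an event of probability at most `1/32`, the Poincaré-type inequality
bounds the first two moments of `‖w‖²`, without any dependence on the dimension. -/
lemma integral_sq_norm_le_and (μ : Measure E) [IsGaussian μ] (hμ : μ[id] = 0) {c : ℝ}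
    (hc : 0 ≤ c) (hvar : ∀ v : E, ∫ x, ⟪v, x⟫ ^ 2 ∂μ ≤ c * ‖v‖ ^ 2) (hw : LipschitzWith 1 w)
    (hgrad : ∀ x y, ‖w y‖ ^ 2 - ‖w x‖ ^ 2 ≤ 2 * ⟪w y, y - x⟫)
    {B : Set E} (hB : MeasurableSet B) (hμB : μ.real B ≤ 1 / 32) (hw0 : ∀ x ∉ B, w x = 0) :
    ∫ x, ‖w x‖ ^ 2 ∂μ ≤ c ∧ ∫ x, (‖w x‖ ^ 2) ^ 2 ∂μ ≤ 4 * c ^ 2 := by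
  have hpoin := integral_sq_sub_sq_integral_le μ hμ hc hvar hw hgrad
  have hF1 := integrable_sq_norm μ hw
  have hF2 := integrable_sq_sq_norm μ hw
  set m := ∫ x, ‖w x‖ ^ 2 ∂μ with hm
  set M := ∫ x, (‖w x‖ ^ 2) ^ 2 ∂μ with hM
  have hm0 : 0 ≤ m := integral_nonneg fun x => sq_nonneg _
  -- Cauchy–Schwarz on `B`, in the form `F² ≥ 2 t F - t² 1_B` with the optimal `t = 32 E F`
  have hCS : 32 * m ^ 2 ≤ M := by
    have h1 : ∫ x, (64 * m * ‖w x‖ ^ 2 - B.indicator (fun _ => 1024 * m ^ 2) x) ∂μ ≤ M := by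
      refine integral_mono ((hF1.const_mul _).sub ((integrable_const _).indicator hB)) hF2
        fun x => ?_
      simp only
      by_cases hx : x ∈ B
      · rw [Set.indicator_of_mem hx]
        nlinarith [sq_nonneg (‖w x‖ ^ 2 - 32 * m)]
      · rw [Set.indicator_of_notMem hx, hw0 x hx]
        simp
    rw [integral_sub (hF1.const_mul _) ((integrable_const _).indicator hB), integral_const_mul,
      integral_indicator_const _ hB, ← hm, smul_eq_mul] at h1
    nlinarith [mul_le_mul_of_nonneg_right hμB (by positivity : 0 ≤ 1024 * m ^ 2)]
  have hpi : Real.pi ^ 2 ≤ 10 := by nlinarith [Real.pi_lt_d2, Real.pi_pos]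
  have hp2 : M - m ^ 2 ≤ 10 * (c * m) := by
    have := mul_le_mul_of_nonneg_right hpi (mul_nonneg hc hm0)
    linarith
  have hmc : m ≤ 10 / 31 * c := by
    by_contra! hlt
    nlinarith
  refine ⟨by linarith, ?_⟩
  nlinarith [mul_le_mul_of_nonneg_left hmc hc, mul_le_mul hmc hmc hm0 (by positivity)]

end Poincare

/-! ### Exponential moments of squared Gaussian variables -/

/-- For a centered normal variable of variance `v ≤ 1`, `E exp(3 x² / 8) = (1 - 3 v / 4)^(-1/2)`,
which is at most `2`. -/
lemma integrable_exp_sq_gaussianReal_and_le (v : NNReal) (hv : v ≤ 1) :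
    Integrable (fun x => Real.exp (3 / 8 * x ^ 2)) (gaussianReal 0 v) ∧
      ∫ x, Real.exp (3 / 8 * x ^ 2) ∂(gaussianReal 0 v) ≤ 2 := by
  rcases eq_or_ne v 0 with rfl | hv0
  · rw [gaussianReal_zero_var]
    refine ⟨integrable_dirac (by simp), ?_⟩
    rw [integral_dirac]
    norm_num
  have hvpos : (0 : ℝ) < v := by positivity
  have hv1 : (v : ℝ) ≤ 1 := by exact_mod_cast hv
  set b : ℝ := 1 / (2 * v) - 3 / 8 with hb
  have hbpos : 0 < b := by
    have : (1 : ℝ) / 2 ≤ 1 / (2 * v) := one_div_le_one_div_of_le (by positivity) (by linarith)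
    rw [hb]; linarith
  have hpdf : ∀ x, gaussianPDFReal 0 v x * Real.exp (3 / 8 * x ^ 2)
      = (Real.sqrt (2 * Real.pi * v))⁻¹ * Real.exp (-b * x ^ 2) := by
    intro x
    rw [gaussianPDFReal_def]
    simp only [sub_zero]
    rw [mul_assoc, ← Real.exp_add]
    congr 2
    rw [hb]; field_simp; ring
  constructor
  · rw [gaussianReal_of_var_ne_zero 0 hv0,
      integrable_withDensity_iff_integrable_smul₀' (by fun_prop)
        (Filter.Eventually.of_forall fun x => gaussianPDF_lt_top)]
    simp only [toReal_gaussianPDF, smul_eq_mul, hpdf]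
    exact (integrable_exp_neg_mul_sq hbpos).const_mul _
  · rw [integral_gaussianReal_eq_integral_smul hv0]
    simp only [smul_eq_mul, hpdf]
    rw [integral_const_mul, integral_gaussian, ← Real.sqrt_inv, ← Real.sqrt_mul (by positivity)]
    refine Real.sqrt_le_iff.2 ⟨by norm_num, ?_⟩
    have h1 : (2 * Real.pi * v)⁻¹ * (Real.pi / b) = 1 / (2 * v * b) := by
      field_simp
    rw [h1, div_le_iff₀ (by positivity), hb]
    have : 2 * (v : ℝ) * (1 / (2 * v) - 3 / 8) = 1 - 3 / 4 * v := by field_simp; ring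
    rw [this]
    linarith

section Gaussian

open scoped RealInnerProductSpace

variable {E : Type*} [NormedAddCommGroup E] [InnerProductSpace ℝ E]

/-- The sublevel set `{∑ₖ exp(3 gₖ² / 8) ≤ 64 p}` of the Gaussian variables `gₖ = ⟪aₖ, ·⟫`. It is
closed and convex, and it controls all order statistics of `(|g₁|, …, |gₚ|)` at once. -/
def expSqSet {p : ℕ} (a : Fin p → E) : Set E :=
  {x | ∑ k, Real.exp (3 / 8 * ⟪a k, x⟫ ^ 2) ≤ 64 * p}

lemma isClosed_expSqSet {p : ℕ} (a : Fin p → E) : IsClosed (expSqSet a) :=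
  isClosed_le (by fun_prop) continuous_const

lemma convex_expSqSet {p : ℕ} (a : Fin p → E) : Convex ℝ (expSqSet a) := by
  have h1 : ConvexOn ℝ Set.univ fun t : ℝ => Real.exp (3 / 8 * t ^ 2) := by
    have h2 : ConvexOn ℝ Set.univ fun t : ℝ => (3 / 8 : ℝ) * t ^ 2 :=
      (even_two.convexOn_pow (𝕜 := ℝ)).smul (by norm_num)
    refine ⟨convex_univ, fun x _ y _ s t hs ht hst => ?_⟩
    exact (Real.exp_le_exp.2 (h2.2 (Set.mem_univ x) (Set.mem_univ y) hs ht hst)).trans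
      (convexOn_exp.2 (Set.mem_univ _) (Set.mem_univ _) hs ht hst)
  intro x hx y hy s t hs ht hst
  simp only [expSqSet, Set.mem_ofPred_eq] at hx hy ⊢
  calc ∑ k, Real.exp (3 / 8 * ⟪a k, s • x + t • y⟫ ^ 2)
      ≤ ∑ k, (s * Real.exp (3 / 8 * ⟪a k, x⟫ ^ 2) + t * Real.exp (3 / 8 * ⟪a k, y⟫ ^ 2)) := by
        refine Finset.sum_le_sum fun k _ => ?_
        rw [inner_add_right, inner_smul_right, inner_smul_right]
        exact h1.2 (Set.mem_univ _) (Set.mem_univ _) hs ht hst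
    _ = s * ∑ k, Real.exp (3 / 8 * ⟪a k, x⟫ ^ 2) + t * ∑ k, Real.exp (3 / 8 * ⟪a k, y⟫ ^ 2) := by
        rw [Finset.sum_add_distrib, Finset.mul_sum, Finset.mul_sum]
    _ ≤ s * (64 * p) + t * (64 * p) := by gcongr
    _ = 64 * p := by rw [← add_mul, hst, one_mul]

lemma zero_mem_expSqSet {p : ℕ} (a : Fin p → E) : (0 : E) ∈ expSqSet a := by
  simp only [expSqSet, Set.mem_ofPred_eq, inner_zero_right]
  simp
  have : (0 : ℝ) ≤ p := Nat.cast_nonneg p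
  linarith

variable [CompleteSpace E] [SecondCountableTopology E] [MeasurableSpace E] [BorelSpace E]

lemma map_inner_eq_gaussianReal (μ : Measure E) [IsGaussian μ] (hμ : μ[id] = 0) (a : E) :
    μ.map (fun x => ⟪a, x⟫) = gaussianReal 0 (∫ x, ⟪a, x⟫ ^ 2 ∂μ).toNNReal := by
  have h := IsGaussian.map_eq_gaussianReal (μ := μ) (innerSL ℝ a)
  have h0 : ∫ x, ⟪a, x⟫ ∂μ = 0 := by
    rw [integral_inner IsGaussian.integrable_fun_id]
    have : ∫ y, y ∂μ = 0 := hμ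
    rw [this, inner_zero_right]
  have h1 : Var[fun x => ⟪a, x⟫; μ] = ∫ x, ⟪a, x⟫ ^ 2 ∂μ :=
    variance_of_integral_eq_zero (by fun_prop) h0
  have e : (⇑(innerSL ℝ a) : E → ℝ) = fun x => ⟪a, x⟫ := rfl
  rw [e, h0, h1] at h
  exact h

/-- Markov's inequality, as `E exp(3 gₖ² / 8) ≤ 2` for each `k`. -/
lemma measureReal_compl_expSqSet_le (μ : Measure E) [IsGaussian μ] (hμ : μ[id] = 0) {p : ℕ}
    (hp : 1 ≤ p) (a : Fin p → E) (ha : ∀ k, ∫ x, ⟪a k, x⟫ ^ 2 ∂μ ≤ 1) :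
    μ.real (expSqSet a)ᶜ ≤ 1 / 32 := by
  have hk : ∀ k, Integrable (fun x => Real.exp (3 / 8 * ⟪a k, x⟫ ^ 2)) μ ∧
      ∫ x, Real.exp (3 / 8 * ⟪a k, x⟫ ^ 2) ∂μ ≤ 2 := by
    intro k
    have h := integrable_exp_sq_gaussianReal_and_le (∫ x, ⟪a k, x⟫ ^ 2 ∂μ).toNNReal
      (Real.toNNReal_le_one.2 (ha k))
    rw [← map_inner_eq_gaussianReal μ hμ (a k)] at h
    rw [integral_map (by fun_prop) (by fun_prop),
      integrable_map_measure (by fun_prop) (by fun_prop)] at h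
    exact h
  have hint : Integrable (fun x => ∑ k, Real.exp (3 / 8 * ⟪a k, x⟫ ^ 2)) μ :=
    integrable_finsetSum _ fun k _ => (hk k).1
  have h1 := mul_meas_ge_le_integral_of_nonneg (μ := μ)
    (Filter.Eventually.of_forall fun x => Finset.sum_nonneg fun k _ => (Real.exp_pos _).le)
    hint (64 * p)
  have h2 : ∫ x, ∑ k, Real.exp (3 / 8 * ⟪a k, x⟫ ^ 2) ∂μ ≤ p * 2 := by
    rw [integral_finsetSum _ fun k _ => (hk k).1]
    refine (Finset.sum_le_sum fun k _ => (hk k).2).trans ?_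
    simp
  have h3 : μ.real (expSqSet a)ᶜ
      ≤ μ.real {x | 64 * (p : ℝ) ≤ ∑ k, Real.exp (3 / 8 * ⟪a k, x⟫ ^ 2)} := by
    refine measureReal_mono fun x hx => ?_
    simp only [expSqSet, Set.mem_compl_iff, Set.mem_ofPred_eq, not_le] at hx ⊢
    exact hx.le
  have hp' : (1 : ℝ) ≤ p := by exact_mod_cast hp
  have h4 : 64 * (p : ℝ) * μ.real (expSqSet a)ᶜ ≤ p * 2 :=
    (mul_le_mul_of_nonneg_left h3 (by positivity)).trans (h1.trans h2)
  have h5 : 0 ≤ μ.real (expSqSet a)ᶜ := measureReal_nonneg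
  by_contra! hlt
  nlinarith

/-- The projection of a Gaussian vector on `expSqSet a` misses it by a vector whose squared norm
has mean at most `c` and second moment at most `4 c²`. -/
lemma exists_displacement_expSqSet (μ : Measure E) [IsGaussian μ] (hμ : μ[id] = 0) {p : ℕ}
    (hp : 1 ≤ p) {c : ℝ} (hc : 0 ≤ c) (hvar : ∀ v : E, ∫ x, ⟪v, x⟫ ^ 2 ∂μ ≤ c * ‖v‖ ^ 2)
    (a : Fin p → E) (ha : ∀ k, ∫ x, ⟪a k, x⟫ ^ 2 ∂μ ≤ 1) :
    ∃ w : E → E, LipschitzWith 1 w ∧ (∀ x, x - w x ∈ expSqSet a) ∧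
      ∫ x, ‖w x‖ ^ 2 ∂μ ≤ c ∧ ∫ x, (‖w x‖ ^ 2) ^ 2 ∂μ ≤ 4 * c ^ 2 := by
  obtain ⟨w, hw, hwK, hw0, hgrad⟩ := exists_displacement ⟨0, zero_mem_expSqSet a⟩
    (isClosed_expSqSet a) (convex_expSqSet a)
  have h := integral_sq_norm_le_and μ hμ hc hvar hw hgrad
    (isClosed_expSqSet a).measurableSet.compl (measureReal_compl_expSqSet_le μ hμ hp a ha)
    fun x hx => hw0 x (not_not.1 hx)
  exact ⟨w, hw, hwK, h⟩

end Gaussian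

/-- If `∑ₖ exp(3 gₖ² / 8) ≤ 64 p`, then at least `j` of the summands are at least
`exp(3 (gⱼ♯)² / 8)`, so that this is at most `64 p / j ≤ (2 p / j)⁶`. -/
lemma rearr_le_of_sum_exp_le {p : ℕ} (g : EuclideanSpace ℝ (Fin p))
    (hg : ∑ k, Real.exp (3 / 8 * g k ^ 2) ≤ 64 * p) (j : Fin p) :
    rearr g j ≤ 4 * Real.sqrt (Real.log (2 * (p : ℝ) / ((j.val : ℝ) + 1))) := by
  set π := Tuple.sort (fun i => -|g i|) with hπ
  set q : ℝ := 2 * (p : ℝ) / ((j.val : ℝ) + 1) with hq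
  have hjp : (j.val : ℝ) + 1 ≤ p := by exact_mod_cast j.2
  have hj0 : (0 : ℝ) < (j.val : ℝ) + 1 := by positivity
  have hq2 : 2 ≤ q := by rw [hq, le_div_iff₀ hj0]; linarith
  have h1 : ((j.val : ℝ) + 1) * Real.exp (3 / 8 * rearr g j ^ 2) ≤ 64 * p := by
    calc ((j.val : ℝ) + 1) * Real.exp (3 / 8 * rearr g j ^ 2)
        = ∑ i ∈ Finset.Iic j, Real.exp (3 / 8 * rearr g j ^ 2) := by
          rw [Finset.sum_const, Fin.card_Iic, nsmul_eq_mul]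
          push_cast
          ring
      _ ≤ ∑ i ∈ Finset.Iic j, Real.exp (3 / 8 * rearr g i ^ 2) := by
          refine Finset.sum_le_sum fun i hi => Real.exp_le_exp.2 ?_
          have h2 : rearr g j ≤ rearr g i := rearr_antitone g (Finset.mem_Iic.1 hi)
          have h3 : 0 ≤ rearr g j := abs_nonneg _
          have h4 := pow_le_pow_left₀ h3 h2 2
          linarith
      _ ≤ ∑ i, Real.exp (3 / 8 * rearr g i ^ 2) :=
          Finset.sum_le_sum_of_subset_of_nonneg (Finset.subset_univ _)
            fun _ _ _ => (Real.exp_pos _).le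
      _ = ∑ i, Real.exp (3 / 8 * g i ^ 2) := by
          rw [← Equiv.sum_comp π fun i => Real.exp (3 / 8 * g i ^ 2)]
          refine Finset.sum_congr rfl fun i _ => ?_
          rw [rearr, sq_abs]
      _ ≤ _ := hg
  have h2 : Real.exp (3 / 8 * rearr g j ^ 2) ≤ q ^ 6 := by
    have h3 : Real.exp (3 / 8 * rearr g j ^ 2) ≤ 32 * q := by
      rw [hq, mul_div_assoc', le_div_iff₀ hj0]
      linarith
    have h4 : (2 : ℝ) ^ 5 ≤ q ^ 5 := pow_le_pow_left₀ (by norm_num) hq2 5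
    calc _ ≤ 32 * q := h3
      _ ≤ q ^ 5 * q := by
          refine mul_le_mul_of_nonneg_right ?_ (by linarith)
          linarith
      _ = q ^ 6 := by ring
  have h3 : 3 / 8 * rearr g j ^ 2 ≤ 6 * Real.log q := by
    have := Real.log_le_log (Real.exp_pos _) h2
    rwa [Real.log_exp, Real.log_pow, Nat.cast_ofNat] at this
  have h4 : 0 ≤ Real.log q := Real.log_nonneg (by linarith)
  refine le_of_sq_le_sq ?_ (by positivity)
  rw [mul_pow, Real.sq_sqrt h4]
  linarith

/-! ### The weights and the restricted eigenvalue -/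

lemma two_le_two_mul_div {p : ℕ} (j : Fin p) : 2 ≤ 2 * (p : ℝ) / ((j.val : ℝ) + 1) := by
  have hjp : (j.val : ℝ) + 1 ≤ p := by exact_mod_cast j.2
  rw [le_div_iff₀ (by positivity)]
  linarith

lemma weights_nonneg {n p : ℕ} {A σ : ℝ} (hA : 0 ≤ A) (hσ : 0 ≤ σ) (j : Fin p) :
    0 ≤ weights n p A σ j :=
  mul_nonneg (mul_nonneg hA hσ) (Real.sqrt_nonneg _)

lemma antitone_weights {n p : ℕ} {A σ : ℝ} (hA : 0 ≤ A) (hσ : 0 ≤ σ) :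
    Antitone (weights n p A σ) := by
  intro i j hij
  refine mul_le_mul_of_nonneg_left (Real.sqrt_le_sqrt ?_) (mul_nonneg hA hσ)
  have hij' : (i.val : ℝ) ≤ j.val := by exact_mod_cast hij
  have h2 := two_le_two_mul_div j
  refine div_le_div_of_nonneg_right ?_ (Nat.cast_nonneg n)
  refine Real.log_le_log (by linarith) ?_
  exact div_le_div_of_nonneg_left (by positivity) (by positivity) (by linarith)

lemma sq_weights {n p : ℕ} (A σ : ℝ) (j : Fin p) :
    weights n p A σ j ^ 2
      = A ^ 2 * σ ^ 2 * (Real.log (2 * (p : ℝ) / ((j.val : ℝ) + 1)) / n) := by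
  have h := Real.log_nonneg (by linarith [two_le_two_mul_div j] :
    1 ≤ 2 * (p : ℝ) / ((j.val : ℝ) + 1))
  rw [weights, mul_pow, Real.sq_sqrt (div_nonneg h (Nat.cast_nonneg n))]
  ring

/-- `log (2p) ≤ k log (2p/k)` for `1 ≤ k ≤ p`, a consequence of `k ≤ 2^(k-1)`. -/
lemma log_two_mul_le {p : ℕ} (j : Fin p) :
    Real.log (2 * (p : ℝ))
      ≤ ((j.val : ℝ) + 1) * Real.log (2 * (p : ℝ) / ((j.val : ℝ) + 1)) := by
  set k : ℝ := (j.val : ℝ) + 1 with hk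
  have hkp : k ≤ p := by rw [hk]; exact_mod_cast j.2
  have hk1 : 1 ≤ k := by rw [hk]; linarith [(Nat.cast_nonneg j.val : (0 : ℝ) ≤ j.val)]
  have hp0 : (0 : ℝ) < p := by linarith
  have h1 : Real.log k ≤ (k - 1) * Real.log 2 := by
    have h2 : k ≤ 2 ^ j.val := by
      rw [hk]
      exact_mod_cast Nat.lt_two_pow_self (n := j.val)
    have h3 := Real.log_le_log (by linarith) h2
    rw [Real.log_pow] at h3
    rw [hk]
    simpa using h3
  have h2 : Real.log k ≤ Real.log p := Real.log_le_log (by linarith) hkp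
  rw [Real.log_div (by positivity) (by positivity), Real.log_mul (by norm_num) hp0.ne']
  nlinarith [mul_le_mul_of_nonneg_left h2 (by linarith : 0 ≤ k - 1)]

/-- Expanding the square of the sorted norm and keeping only the pairs `i ≤ j` bounds it below by
`∑ⱼ (j + 1) lⱼ² (uⱼ♯)²`. -/
lemma mul_norm_le_starNorm {p : ℕ} {l : Fin p → ℝ} (hl : Antitone l) (hl0 : ∀ j, 0 ≤ l j)
    {c : ℝ} (h : ∀ j, c ^ 2 ≤ ((j.val : ℝ) + 1) * l j ^ 2)
    (u : EuclideanSpace ℝ (Fin p)) : c * ‖u‖ ≤ starNorm l u := by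
  refine le_of_sq_le_sq ?_ (starNorm_nonneg hl0 u)
  have hr0 : ∀ j, 0 ≤ rearr u j := fun j => abs_nonneg _
  have hnorm : ‖u‖ ^ 2 = ∑ j, rearr u j ^ 2 := by
    rw [EuclideanSpace.norm_sq_eq, ← Equiv.sum_comp (Tuple.sort fun i => -|u i|)]
    rfl
  have hterm : ∀ j, 0 ≤ l j * rearr u j := fun j => mul_nonneg (hl0 j) (hr0 j)
  calc (c * ‖u‖) ^ 2 = ∑ j, c ^ 2 * rearr u j ^ 2 := by rw [mul_pow, hnorm, Finset.mul_sum]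
    _ ≤ ∑ j, ((j.val : ℝ) + 1) * l j ^ 2 * rearr u j ^ 2 :=
        Finset.sum_le_sum fun j _ => mul_le_mul_of_nonneg_right (h j) (sq_nonneg _)
    _ = ∑ j, ∑ i ∈ Finset.Iic j, (l j * rearr u j) * (l j * rearr u j) := by
        refine Finset.sum_congr rfl fun j _ => ?_
        rw [Finset.sum_const, Fin.card_Iic, nsmul_eq_mul]
        push_cast
        ring
    _ ≤ ∑ j, ∑ i ∈ Finset.Iic j, (l j * rearr u j) * (l i * rearr u i) := by
        refine Finset.sum_le_sum fun j _ => Finset.sum_le_sum fun i hi => ?_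
        have hij := Finset.mem_Iic.1 hi
        exact mul_le_mul_of_nonneg_left
          (mul_le_mul (hl hij) (rearr_antitone u hij) (hr0 j) (hl0 i)) (hterm j)
    _ ≤ ∑ j, ∑ i, (l j * rearr u j) * (l i * rearr u i) :=
        Finset.sum_le_sum fun j _ => Finset.sum_le_sum_of_subset_of_nonneg (Finset.subset_univ _)
          fun i _ _ => mul_nonneg (hterm j) (hterm i)
    _ = starNorm l u ^ 2 := by rw [starNorm, sq, Finset.sum_mul_sum]

lemma empNorm_nonneg {n : ℕ} (u : EuclideanSpace ℝ (Fin n)) : 0 ≤ empNorm u := Real.sqrt_nonneg _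

lemma sq_empNorm {n : ℕ} (u : EuclideanSpace ℝ (Fin n)) :
    empNorm u ^ 2 = (1 / (n : ℝ)) * ‖u‖ ^ 2 := by
  rw [empNorm, Real.sq_sqrt, EuclideanSpace.norm_sq_eq]
  · simp
  · exact mul_nonneg (by positivity) (Finset.sum_nonneg fun i _ => sq_nonneg _)

lemma norm_eq_sqrt_mul_empNorm {n : ℕ} (hn : 1 ≤ n) (u : EuclideanSpace ℝ (Fin n)) :
    ‖u‖ = Real.sqrt n * empNorm u := by
  have hn' : (0 : ℝ) < n := by exact_mod_cast hn
  have h : ‖u‖ ^ 2 = (Real.sqrt n * empNorm u) ^ 2 := by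
    rw [mul_pow, Real.sq_sqrt hn'.le, sq_empNorm]
    field_simp
  exact (sq_eq_sq₀ (norm_nonneg _) (mul_nonneg (Real.sqrt_nonneg _) (empNorm_nonneg _))).1 h

lemma wreConst_mul_norm_le {n p : ℕ} (X : Matrix (Fin n) (Fin p) ℝ) (l : Fin p → ℝ) (s : ℕ)
    (c₀ : ℝ) {δ : EuclideanSpace ℝ (Fin p)} (hδ : δ ∈ wreCone l s c₀) :
    wreConst X l s c₀ * ‖δ‖ ≤ empNorm (predict X δ) := by
  rcases eq_or_ne δ 0 with rfl | h0
  · simpa using empNorm_nonneg _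
  rw [← le_div_iff₀ (norm_pos_iff.2 h0)]
  refine csInf_le ⟨0, ?_⟩ ⟨δ, hδ, h0, rfl⟩
  rintro r ⟨δ', -, -, rfl⟩
  exact div_nonneg (empNorm_nonneg _) (norm_nonneg _)

lemma wreConst_le_wreConst {n p : ℕ} (X : Matrix (Fin n) (Fin p) ℝ) (l : Fin p → ℝ) (s : ℕ)
    {c₁ c₂ : ℝ} (hc : c₁ ≤ c₂) {δ : EuclideanSpace ℝ (Fin p)} (hδ : δ ∈ wreCone l s c₁)
    (h0 : δ ≠ 0) : wreConst X l s c₂ ≤ wreConst X l s c₁ := by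
  refine csInf_le_csInf ⟨0, ?_⟩ ⟨_, δ, hδ, h0, rfl⟩ ?_
  · rintro r ⟨δ', -, -, rfl⟩
    exact div_nonneg (empNorm_nonneg _) (norm_nonneg _)
  · rintro r ⟨δ', hδ', h0', rfl⟩
    simp only [wreCone, Set.mem_ofPred_eq] at hδ'
    refine ⟨δ', ?_, h0', rfl⟩
    simp only [wreCone, Set.mem_ofPred_eq]
    refine hδ'.trans ?_
    gcongr

/-! ### The noise term -/

open scoped RealInnerProductSpace

lemma predict_eq_sum {n p : ℕ} (X : Matrix (Fin n) (Fin p) ℝ) (u : EuclideanSpace ℝ (Fin p)) :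
    predict X u = ∑ k, u k • predict X (EuclideanSpace.single k 1) := by
  have h := (EuclideanSpace.basisFun (Fin p) ℝ).sum_repr u
  simp only [EuclideanSpace.basisFun_repr, EuclideanSpace.basisFun_apply] at h
  conv_lhs => rw [← h]
  simp only [predict, map_sum, map_smul]

/-- The columns of `X`, scaled so that the inner products with an `N(0, σ² I)` vector have
variance at most one. -/
noncomputable def scaledColumn {n p : ℕ} (X : Matrix (Fin n) (Fin p) ℝ) (σ : ℝ) (k : Fin p) :
    EuclideanSpace ℝ (Fin n) :=
  (σ * Real.sqrt n)⁻¹ • predict X (EuclideanSpace.single k 1)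

/-- On `expSqSet`, the noise term is controlled by the sorted norm alone, by the rearrangement
inequality and the bound on the order statistics. -/
lemma inner_predict_le_of_mem_expSqSet {n p : ℕ} (hn : 1 ≤ n) (X : Matrix (Fin n) (Fin p) ℝ)
    {A σ : ℝ} (hA : 0 < A) (hσ : 0 < σ) {x : EuclideanSpace ℝ (Fin n)}
    (hx : x ∈ expSqSet (scaledColumn X σ)) (u : EuclideanSpace ℝ (Fin p)) :
    1 / (n : ℝ) * ⟪x, predict X u⟫ ≤ 4 / A * starNorm (weights n p A σ) u := by
  have hn' : (0 : ℝ) < n := by exact_mod_cast hn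
  set N := Real.sqrt n with hN
  have hN0 : 0 < N := Real.sqrt_pos.2 hn'
  have hNN : N * N = n := Real.mul_self_sqrt hn'.le
  set g : EuclideanSpace ℝ (Fin p) := WithLp.toLp 2 fun k => ⟪scaledColumn X σ k, x⟫ with hg
  have hgk : ∀ k, g k = ⟪scaledColumn X σ k, x⟫ := fun k => rfl
  have hinner : ⟪x, predict X u⟫ = σ * N * ∑ k, u k * g k := by
    rw [predict_eq_sum, inner_sum, Finset.mul_sum]
    refine Finset.sum_congr rfl fun k _ => ?_
    rw [hgk, scaledColumn, inner_smul_right, inner_smul_left, real_inner_comm x]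
    simp only [conj_trivial]
    rw [← hN]
    field_simp
  have hsum : ∑ k, u k * g k ≤ ∑ j, rearr u j * rearr g j := by
    set π := Tuple.sort (fun i => -|u i|) with hπ
    calc ∑ k, u k * g k ≤ ∑ k, |u k| * |g k| := by
          refine Finset.sum_le_sum fun k _ => ?_
          rw [← abs_mul]
          exact le_abs_self _
      _ = ∑ j, rearr u j * |g (π j)| := (Equiv.sum_comp π fun k => |u k| * |g k|).symm
      _ ≤ starNorm (rearr u) g := sum_mul_abs_comp_perm_le_starNorm (rearr_antitone u) g π
  have hg' : ∀ j, rearr g j ≤ 4 * Real.sqrt (Real.log (2 * (p : ℝ) / ((j.val : ℝ) + 1))) :=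
    rearr_le_of_sum_exp_le g hx
  calc 1 / (n : ℝ) * ⟪x, predict X u⟫ = σ / N * ∑ k, u k * g k := by
        rw [hinner, ← hNN]
        field_simp
    _ ≤ σ / N * ∑ j, rearr u j
          * (4 * Real.sqrt (Real.log (2 * (p : ℝ) / ((j.val : ℝ) + 1)))) := by
        refine mul_le_mul_of_nonneg_left (hsum.trans ?_) (by positivity)
        exact Finset.sum_le_sum fun j _ => mul_le_mul_of_nonneg_left (hg' j) (abs_nonneg _)
    _ = 4 / A * starNorm (weights n p A σ) u := by
        rw [starNorm, Finset.mul_sum, Finset.mul_sum]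
        refine Finset.sum_congr rfl fun j _ => ?_
        rw [weights, Real.sqrt_div' _ hn'.le, ← hN]
        field_simp

/-- The noise term is at most the larger of the sorted norm and a multiple of the prediction norm,
the factor being proportional to the size of a displacement `v` of the noise to `expSqSet`. -/
lemma inner_predict_le_max {n p : ℕ} (hn : 1 ≤ n) (X : Matrix (Fin n) (Fin p) ℝ)
    {A σ : ℝ} (hA : 2 * (4 + Real.sqrt 2) ≤ A) (hσ : 0 < σ) {x v : EuclideanSpace ℝ (Fin n)}
    (hx : x - v ∈ expSqSet (scaledColumn X σ)) (u : EuclideanSpace ℝ (Fin p)) :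
    2 / (n : ℝ) * ⟪x, predict X u⟫ ≤ max (starNorm (weights n p A σ) u)
      (A * ‖v‖ / Real.sqrt (2 * n) * empNorm (predict X u)) := by
  have hn' : (0 : ℝ) < n := by exact_mod_cast hn
  have h2 : 0 ≤ Real.sqrt 2 := Real.sqrt_nonneg 2
  have hA0 : 0 < A := by linarith
  have h1 := inner_predict_le_of_mem_expSqSet hn X hA0 hσ hx u
  set S := starNorm (weights n p A σ) u with hS
  set e := empNorm (predict X u) with he
  set B := A * ‖v‖ / Real.sqrt (2 * n) with hB
  have h3 : 1 / (n : ℝ) * ⟪v, predict X u⟫ ≤ Real.sqrt 2 / A * (B * e) := by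
    have h4 := real_inner_le_norm v (predict X u)
    rw [norm_eq_sqrt_mul_empNorm hn (predict X u), ← he] at h4
    have hnn : Real.sqrt n * Real.sqrt n = n := Real.mul_self_sqrt hn'.le
    have hs0 : 0 < Real.sqrt n := Real.sqrt_pos.2 hn'
    calc 1 / (n : ℝ) * ⟪v, predict X u⟫ ≤ 1 / (n : ℝ) * (‖v‖ * (Real.sqrt n * e)) :=
          mul_le_mul_of_nonneg_left h4 (by positivity)
      _ = _ := by
          have h5 : 1 / (n : ℝ) * Real.sqrt n = 1 / Real.sqrt n := by
            rw [div_mul_eq_mul_div, div_eq_div_iff hn'.ne' hs0.ne']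
            linarith
          have h6 : 0 < Real.sqrt 2 := by positivity
          calc 1 / (n : ℝ) * (‖v‖ * (Real.sqrt n * e)) = ‖v‖ * e * (1 / n * Real.sqrt n) := by ring
            _ = _ := by
                rw [h5, hB, Real.sqrt_mul (by norm_num)]
                field_simp
  have hsplit : 2 / (n : ℝ) * ⟪x, predict X u⟫
      = 2 * (1 / (n : ℝ) * ⟪x - v, predict X u⟫) + 2 * (1 / (n : ℝ) * ⟪v, predict X u⟫) := by
    rw [inner_sub_left]; ring
  set m := max S (B * e) with hm
  have hm0 : 0 ≤ m := le_max_of_le_left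
    (starNorm_nonneg (weights_nonneg hA0.le hσ.le) u)
  have h5 : 4 / A * S ≤ 4 / A * m := mul_le_mul_of_nonneg_left (le_max_left _ _) (by positivity)
  have h6 : Real.sqrt 2 / A * (B * e) ≤ Real.sqrt 2 / A * m :=
    mul_le_mul_of_nonneg_left (le_max_right _ _) (by positivity)
  have h7 : 2 * (4 / A * m) + 2 * (Real.sqrt 2 / A * m) ≤ m := by
    have h8 : 2 * (4 / A * m) + 2 * (Real.sqrt 2 / A * m) = 2 * (4 + Real.sqrt 2) / A * m := by
      ring
    rw [h8]
    refine mul_le_of_le_one_left hm0 ?_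
    rw [div_le_one hA0]
    exact hA
  linarith

/-! ### Deterministic oracle inequalities -/

/-- The basic inequality for the Slope estimator, with the additional term `‖X (b - β)‖_n²` that
comes from the strong convexity of the squared loss. -/
lemma IsSlopeSolution.basic_inequality {n p : ℕ} {X : Matrix (Fin n) (Fin p) ℝ} {l : Fin p → ℝ}
    (hl : Antitone l) (hl0 : ∀ j, 0 ≤ l j) {f x : EuclideanSpace ℝ (Fin n)}
    {b : EuclideanSpace ℝ (Fin p)} (hb : IsSlopeSolution X l (f + x) b)
    (β : EuclideanSpace ℝ (Fin p)) :
    empNorm (predict X b - f) ^ 2 + empNorm (predict X (b - β)) ^ 2 + 2 * starNorm l b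
      ≤ empNorm (predict X β - f) ^ 2 + 2 / (n : ℝ) * ⟪x, predict X (b - β)⟫
        + 2 * starNorm l β := by
  set r := predict X b - (f + x) with hr
  set d := predict X (β - b) with hd
  set q := empNorm d ^ 2 with hq
  have hq0 : 0 ≤ q := sq_nonneg _
  have hexp : ∀ (v : EuclideanSpace ℝ (Fin n)) (t : ℝ), empNorm (v + t • d) ^ 2
      = empNorm v ^ 2 + 2 * t / n * ⟪v, d⟫ + t ^ 2 * q := by
    intro v t
    rw [hq, sq_empNorm, sq_empNorm, sq_empNorm, norm_add_sq_real, inner_smul_right, norm_smul,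
      mul_pow, Real.norm_eq_abs, sq_abs]
    ring
  set G := 2 / (n : ℝ) * ⟪r, d⟫ + 2 * (starNorm l β - starNorm l b) with hG
  have hdir : ∀ t : ℝ, 0 < t → t ≤ 1 → 0 ≤ G + t * q := by
    intro t ht ht1
    have h1 := hb (b + t • (β - b))
    have h2 : predict X (b + t • (β - b)) - (f + x) = r + t • d := by
      simp only [predict, map_add, map_smul, hr, hd]
      abel
    have h3 : starNorm l (b + t • (β - b)) ≤ (1 - t) * starNorm l b + t * starNorm l β := by
      have e : b + t • (β - b) = (1 - t) • b + t • β := by module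
      rw [e]
      refine (starNorm_add_le hl hl0 _ _).trans (add_le_add ?_ ?_)
      · have := starNorm_smul_le hl (1 - t) b
        rwa [abs_of_nonneg (by linarith)] at this
      · have := starNorm_smul_le hl t β
        rwa [abs_of_pos ht] at this
    rw [h2, hexp r t] at h1
    have h4 : 0 ≤ t * (G + t * q) := by
      have : t * (G + t * q) = 2 * t / n * ⟪r, d⟫ + t ^ 2 * q
          + 2 * ((1 - t) * starNorm l b + t * starNorm l β) - 2 * starNorm l b := by
        rw [hG]; ring
      rw [this]
      linarith
    exact nonneg_of_mul_nonneg_right h4 ht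
  have hG0 : 0 ≤ G := by
    by_contra! hneg
    have hqG : 0 < q - G := by linarith
    have h1 := hdir (-G / (q - G)) (div_pos (by linarith) hqG)
      ((div_le_one hqG).2 (by linarith))
    have h2 : G + -G / (q - G) * q = -(G ^ 2 / (q - G)) := by field_simp; ring
    rw [h2] at h1
    have h3 : 0 < G ^ 2 / (q - G) := div_pos (sq_pos_iff.2 hneg.ne) hqG
    linarith
  have hβ : empNorm (predict X β - f) ^ 2
      = empNorm (predict X b - f) ^ 2 + 2 / n * ⟪predict X b - f, d⟫ + q := by
    have e : predict X β - f = (predict X b - f) + (1 : ℝ) • d := by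
      simp only [predict, hd, map_sub]
      module
    rw [e, hexp]
    ring
  have hneg : predict X (b - β) = -d := by
    simp only [predict, hd, map_sub]
    abel
  have hinner : ⟪r, d⟫ = ⟪predict X b - f, d⟫ - ⟪x, d⟫ := by
    rw [hr, ← sub_sub, inner_sub_left]
  have hq' : empNorm (-d) ^ 2 = q := by rw [hq, sq_empNorm, sq_empNorm, norm_neg]
  rw [hneg, hq', hβ, inner_neg_right]
  rw [hG, hinner] at hG0
  linarith

/-- The oracle inequality for given noise, in terms of a displacement `v` of the noise to
`expSqSet`. Either the sorted norm dominates the noise term, and then the restricted eigenvalue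
applies, or the error is bounded through `v` alone. -/
lemma prediction_error_le {n p : ℕ} (hn : 1 ≤ n) (X : Matrix (Fin n) (Fin p) ℝ)
    {A σ : ℝ} (hσ : 0 < σ) (hA : 2 * (4 + Real.sqrt 2) ≤ A) {s : ℕ}
    (hX : 0 < wreConst X (weights n p A σ) s 7) {f x v : EuclideanSpace ℝ (Fin n)}
    (hx : x - v ∈ expSqSet (scaledColumn X σ)) {b : EuclideanSpace ℝ (Fin p)}
    (hb : IsSlopeSolution X (weights n p A σ) (f + x) b) {β : EuclideanSpace ℝ (Fin p)}
    (hβ : l0 β ≤ s) :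
    1 / 2 * starNorm (weights n p A σ) (b - β) + empNorm (predict X b - f) ^ 2
      ≤ empNorm (predict X β - f) ^ 2 + 49 / 16 * (sumSq (weights n p A σ) s
          / wreConst X (weights n p A σ) s 7 ^ 2)
        + 49 / 16 * (A ^ 2 / (2 * n) * ‖v‖ ^ 2) := by
  have hA0 : 0 < A := by linarith [Real.sqrt_nonneg 2]
  have hl := antitone_weights (n := n) (p := p) hA0.le hσ.le
  have hl0 := weights_nonneg (n := n) (p := p) hA0.le hσ.le
  have h1 := hb.basic_inequality hl hl0 β
  have h2 := inner_predict_le_max hn X hA hσ hx (b - β)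
  obtain ⟨τ, h3, h4⟩ := exists_tail_of_l0_le hl hl0 s β (b - β) hβ
  rw [add_sub_cancel] at h3
  have h5 : starNorm (weights n p A σ) β - starNorm (weights n p A σ) b
      ≤ starNorm (weights n p A σ) (b - β) :=
    starNorm_sub_starNorm_le hl hl0 β b
  have hcone : starNorm (weights n p A σ) (b - β)
      ≤ 8 * (Real.sqrt (sumSq (weights n p A σ) s) * ‖b - β‖) →
      wreConst X (weights n p A σ) s 7 * ‖b - β‖ ≤ empNorm (predict X (b - β)) := by
    intro h
    refine wreConst_mul_norm_le X _ s 7 ?_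
    simp only [wreCone, Set.mem_ofPred_eq]
    linarith
  have hLam : sumSq (weights n p A σ) s = Real.sqrt (sumSq (weights n p A σ) s) ^ 2 :=
    (Real.sq_sqrt (Finset.sum_nonneg fun _ _ => sq_nonneg _)).symm
  have hB : A ^ 2 / (2 * n) * ‖v‖ ^ 2 = (A * ‖v‖ / Real.sqrt (2 * n)) ^ 2 := by
    rw [div_pow, Real.sq_sqrt (by positivity)]
    ring
  rw [hB]
  have he0 := empNorm_nonneg (predict X (b - β))
  have hΛ0 := Real.sqrt_nonneg (sumSq (weights n p A σ) s)
  rw [hLam]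
  set Λ := Real.sqrt (sumSq (weights n p A σ) s)
  set S := starNorm (weights n p A σ) (b - β)
  set e := empNorm (predict X (b - β))
  set B := A * ‖v‖ / Real.sqrt (2 * n)
  set θ := wreConst X (weights n p A σ) s 7
  have hR0 : 0 ≤ 49 / 16 * (Λ ^ 2 / θ ^ 2) := by positivity
  have hB0 : 0 ≤ 49 / 16 * B ^ 2 := by positivity
  rcases le_total S (B * e) with hcase | hcase
  · rw [max_eq_right hcase] at h2
    -- the excess is at most `7/2 B e - e²`; complete the square
    nlinarith [sq_nonneg (7 / 4 * B - e)]
  · rw [max_eq_left hcase] at h2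
    rcases le_or_gt (S) (8 * (Λ * ‖b - β‖)) with hS | hS
    · have h6 := hcone hS
      have h7 : Λ * ‖b - β‖ ≤ Λ / θ * e := by
        rw [div_mul_eq_mul_div, le_div_iff₀ hX]
        calc Λ * ‖b - β‖ * θ = Λ * (θ * ‖b - β‖) := by ring
          _ ≤ Λ * e := mul_le_mul_of_nonneg_left h6 hΛ0
      have h8 : Λ ^ 2 / θ ^ 2 = (Λ / θ) ^ 2 := by rw [div_pow]
      rw [h8] at hR0 ⊢
      nlinarith [sq_nonneg (7 / 4 * (Λ / θ) - e)]
    · nlinarith [sq_nonneg e]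

/-- The estimation bound for given noise, in terms of a displacement `v` of the noise to
`expSqSet` and of a constant `c` such that `c |·|₂ ≤ |·|_*`. -/
lemma estimation_error_le {n p : ℕ} (hn : 1 ≤ n) (X : Matrix (Fin n) (Fin p) ℝ)
    {A σ : ℝ} (hσ : 0 < σ) (hA : 2 * (4 + Real.sqrt 2) ≤ A) {s : ℕ}
    (hX : 0 < wreConst X (weights n p A σ) s 7) {x v : EuclideanSpace ℝ (Fin n)}
    (hx : x - v ∈ expSqSet (scaledColumn X σ)) {b β : EuclideanSpace ℝ (Fin p)}
    (hb : IsSlopeSolution X (weights n p A σ) (predict X β + x) b) (hβ : l0 β ≤ s) {c : ℝ}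
    (hc : 0 < c) (hcS : ∀ u, c * ‖u‖ ≤ starNorm (weights n p A σ) u) :
    ‖b - β‖ ^ 2 ≤ 9 / 4 * (sumSq (weights n p A σ) s / wreConst X (weights n p A σ) s 3 ^ 4)
      + 9 / 4 * (A ^ 4 / (4 * n ^ 2) * (‖v‖ ^ 2) ^ 2 / c ^ 2) := by
  have hA0 : 0 < A := by linarith [Real.sqrt_nonneg 2]
  have hl := antitone_weights (n := n) (p := p) hA0.le hσ.le
  have hl0 := weights_nonneg (n := n) (p := p) hA0.le hσ.le
  have h1 := hb.basic_inequality hl hl0 β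
  have h2 := inner_predict_le_max hn X hA hσ hx (b - β)
  obtain ⟨τ, h3, h4⟩ := exists_tail_of_l0_le hl hl0 s β (b - β) hβ
  rw [add_sub_cancel] at h3
  have h5 : starNorm (weights n p A σ) β - starNorm (weights n p A σ) b
      ≤ starNorm (weights n p A σ) (b - β) :=
    starNorm_sub_starNorm_le hl hl0 β b
  have hsum0 : 0 ≤ sumSq (weights n p A σ) s := Finset.sum_nonneg fun _ _ => sq_nonneg _
  have hR0 : 0 ≤ 9 / 4 * (sumSq (weights n p A σ) s / wreConst X (weights n p A σ) s 3 ^ 4) :=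
    mul_nonneg (by norm_num) (div_nonneg hsum0 (by positivity))
  have hpred : empNorm (predict X β - predict X β) ^ 2 = 0 := by simp [sq_empNorm]
  have hpred' : predict X b - predict X β = predict X (b - β) := by simp [predict]
  rw [hpred, hpred'] at h1
  have he0 := empNorm_nonneg (predict X (b - β))
  have hd0 := norm_nonneg (b - β)
  have hB : A ^ 4 / (4 * n ^ 2) * (‖v‖ ^ 2) ^ 2 = (A * ‖v‖ / Real.sqrt (2 * n)) ^ 4 := by
    have e : Real.sqrt (2 * n) ^ 4 = (2 * n) ^ 2 := by
      rw [show (4 : ℕ) = 2 * 2 by norm_num, pow_mul, Real.sq_sqrt (by positivity)]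
    rw [div_pow, e]
    ring
  rw [hB]
  have hcS' := hcS (b - β)
  rcases le_total (starNorm (weights n p A σ) (b - β))
    (A * ‖v‖ / Real.sqrt (2 * n) * empNorm (predict X (b - β))) with hcase | hcase
  · rw [max_eq_right hcase] at h2
    set S := starNorm (weights n p A σ) (b - β)
    set e := empNorm (predict X (b - β))
    set B := A * ‖v‖ / Real.sqrt (2 * n)
    have hB0 : 0 ≤ B := by positivity
    -- here `2 e² ≤ B e + 2 S ≤ 3 B e`
    have he : e ≤ 3 / 2 * B := by
      by_contra! hlt
      nlinarith
    have hS : c * ‖b - β‖ ≤ 3 / 2 * B ^ 2 := by nlinarith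
    have h6 : ‖b - β‖ ≤ 3 / 2 * B ^ 2 / c := by rw [le_div_iff₀ hc]; linarith
    have h7 := pow_le_pow_left₀ hd0 h6 2
    have h8 : (3 / 2 * B ^ 2 / c) ^ 2 = 9 / 4 * (B ^ 4 / c ^ 2) := by ring
    linarith
  · rw [max_eq_left hcase] at h2
    have hlast : 0 ≤ 9 / 4 * ((A * ‖v‖ / Real.sqrt (2 * n)) ^ 4 / c ^ 2) := by positivity
    rcases eq_or_ne (b - β) 0 with h0 | h0
    · rw [h0, norm_zero]
      simp only [ne_eq, OfNat.ofNat_ne_zero, not_false_eq_true, zero_pow]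
      linarith
    have hmem : b - β ∈ wreCone (weights n p A σ) s 3 := by
      simp only [wreCone, Set.mem_ofPred_eq]
      nlinarith [sq_nonneg (empNorm (predict X (b - β)))]
    have h6 := wreConst_mul_norm_le X _ s 3 hmem
    have hθ : 0 < wreConst X (weights n p A σ) s 3 :=
      hX.trans_le (wreConst_le_wreConst X _ s (by norm_num) hmem h0)
    have hLam : sumSq (weights n p A σ) s = Real.sqrt (sumSq (weights n p A σ) s) ^ 2 :=
      (Real.sq_sqrt hsum0).symm
    rw [hLam]
    set Λ := Real.sqrt (sumSq (weights n p A σ) s)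
    set S := starNorm (weights n p A σ) (b - β)
    set e := empNorm (predict X (b - β))
    set θ := wreConst X (weights n p A σ) s 3
    have hdpos : 0 < ‖b - β‖ := norm_pos_iff.2 h0
    have h7 : (θ * ‖b - β‖) ^ 2 ≤ e ^ 2 := pow_le_pow_left₀ (by positivity) h6 2
    have h8 : 2 * θ ^ 2 * ‖b - β‖ ≤ 3 * Λ := by
      have : (2 * θ ^ 2 * ‖b - β‖) * ‖b - β‖ ≤ (3 * Λ) * ‖b - β‖ := by nlinarith
      exact le_of_mul_le_mul_right this hdpos
    have h9 : ‖b - β‖ ≤ 3 / 2 * Λ / θ ^ 2 := by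
      rw [le_div_iff₀ (by positivity)]
      linarith
    have h10 := pow_le_pow_left₀ hd0 h9 2
    have h11 : (3 / 2 * Λ / θ ^ 2) ^ 2 = 9 / 4 * (Λ ^ 2 / θ ^ 4) := by ring
    linarith

/-! ### Integration over the noise -/

lemma integral_sq_inner_multivariateGaussian {n : ℕ} (σ : ℝ) (v : EuclideanSpace ℝ (Fin n)) :
    ∫ x, ⟪v, x⟫ ^ 2 ∂(multivariateGaussian 0 (σ ^ 2 • (1 : Matrix (Fin n) (Fin n) ℝ)))
      = σ ^ 2 * ‖v‖ ^ 2 := by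
  have hS : (σ ^ 2 • (1 : Matrix (Fin n) (Fin n) ℝ)).PosSemidef :=
    Matrix.PosSemidef.one.smul (sq_nonneg σ)
  have h := covarianceBilin_multivariateGaussian (μ := 0) hS v v
  rw [covarianceBilin_apply IsGaussian.memLp_two_id] at h
  simp only [integral_id_multivariateGaussian', sub_zero] at h
  rw [EuclideanSpace.norm_sq_eq]
  simp only [← sq] at h
  rw [h, Matrix.smul_mulVec, Matrix.one_mulVec, dotProduct_smul, dotProduct]
  simp [sq]

/-- The distance of the noise to `expSqSet`, as a function of the noise, has a second moment at
most `σ²` and a fourth moment at most `4 σ⁴`, whatever the dimensions. -/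
lemma exists_noise_displacement {n p : ℕ} (hn : 1 ≤ n) (hp : 1 ≤ p)
    (X : Matrix (Fin n) (Fin p) ℝ) {σ : ℝ} (hσ : 0 < σ)
    (hX : ∀ j : Fin p, empNorm (predict X (EuclideanSpace.single j 1)) ≤ 1)
    {Ω : Type*} [MeasurableSpace Ω] {P : Measure Ω} {ξ : Ω → EuclideanSpace ℝ (Fin n)}
    (hξ : HasLaw ξ (multivariateGaussian 0 (σ ^ 2 • (1 : Matrix (Fin n) (Fin n) ℝ))) P) :
    ∃ v : Ω → EuclideanSpace ℝ (Fin n),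
      (∀ ω, ξ ω - v ω ∈ expSqSet (scaledColumn X σ)) ∧
      Integrable (fun ω => ‖v ω‖ ^ 2) P ∧ ∫ ω, ‖v ω‖ ^ 2 ∂P ≤ σ ^ 2 ∧
      Integrable (fun ω => (‖v ω‖ ^ 2) ^ 2) P ∧ ∫ ω, (‖v ω‖ ^ 2) ^ 2 ∂P ≤ 4 * σ ^ 4 := by
  have hn' : (0 : ℝ) < n := by exact_mod_cast hn
  set μ := multivariateGaussian (0 : EuclideanSpace ℝ (Fin n))
    (σ ^ 2 • (1 : Matrix (Fin n) (Fin n) ℝ)) with hμ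
  have ha : ∀ k, ∫ x, ⟪scaledColumn X σ k, x⟫ ^ 2 ∂μ ≤ 1 := by
    intro k
    rw [integral_sq_inner_multivariateGaussian, scaledColumn, norm_smul, mul_pow,
      Real.norm_eq_abs, sq_abs, inv_pow, mul_pow, Real.sq_sqrt hn'.le]
    have h1 := pow_le_pow_left₀ (empNorm_nonneg _) (hX k) 2
    rw [sq_empNorm, one_pow] at h1
    refine le_trans (le_of_eq ?_) h1
    field_simp
  obtain ⟨w, hw, hwK, h1, h2⟩ := exists_displacement_expSqSet μ
    (integral_id_multivariateGaussian') hp (sq_nonneg σ)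
    (fun v => (integral_sq_inner_multivariateGaussian σ v).le) (scaledColumn X σ) ha
  have hi1 := integrable_sq_norm μ hw
  have hi2 := integrable_sq_sq_norm μ hw
  refine ⟨fun ω => w (ξ ω), fun ω => hwK _, ?_, ?_, ?_, ?_⟩
  · rw [← hξ.map_eq] at hi1
    exact hi1.comp_aemeasurable hξ.aemeasurable
  · rw [← hξ.map_eq] at h1 hi1
    rwa [integral_map hξ.aemeasurable hi1.aestronglyMeasurable] at h1
  · rw [← hξ.map_eq] at hi2
    exact hi2.comp_aemeasurable hξ.aemeasurable
  · rw [← hξ.map_eq] at h2 hi2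
    rw [integral_map hξ.aemeasurable hi2.aestronglyMeasurable] at h2
    linarith

lemma integrable_and_integral_le_of_ae_le {Ω : Type*} [MeasurableSpace Ω] {P : Measure Ω}
    [IsProbabilityMeasure P] {Z G : Ω → ℝ} (hZ : AEStronglyMeasurable Z P) (hZ0 : ∀ ω, 0 ≤ Z ω)
    (hG : Integrable G P) {a b m : ℝ} (hb : 0 ≤ b) (hGm : ∫ ω, G ω ∂P ≤ m)
    (hle : ∀ᵐ ω ∂P, Z ω ≤ a + b * G ω) :
    Integrable Z P ∧ ∫ ω, Z ω ∂P ≤ a + b * m := by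
  have hdom : Integrable (fun ω => a + b * G ω) P := (integrable_const a).add (hG.const_mul b)
  have hint : Integrable Z P := by
    refine hdom.mono' hZ ?_
    filter_upwards [hle] with ω hω
    rwa [Real.norm_eq_abs, abs_of_nonneg (hZ0 ω)]
  refine ⟨hint, (integral_mono_ae hint hdom hle).trans ?_⟩
  rw [integral_add (integrable_const a) (hG.const_mul b), integral_const_mul]
  simp only [integral_const, probReal_univ, one_smul]
  linarith [mul_le_mul_of_nonneg_left hGm hb]

end Slope

theorem mainTheorem7 {n p : ℕ} (hn : 1 ≤ n)
    (X : Matrix (Fin n) (Fin p) ℝ)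
    (σ A : ℝ) (hσ : 0 < σ) (hA : 2 * (4 + Real.sqrt 2) ≤ A)
    (s : ℕ) (hs : 1 ≤ s) (hsp : s ≤ p)
    (hX : Slope.WRE X (Slope.weights n p A σ) s 7)
    {Ω : Type*} [MeasurableSpace Ω] (P : Measure Ω) [IsProbabilityMeasure P]
    (ξ : Ω → EuclideanSpace ℝ (Fin n))
    (hξ : HasLaw ξ (multivariateGaussian 0 (σ ^ 2 • (1 : Matrix (Fin n) (Fin n) ℝ))) P)
    (f : EuclideanSpace ℝ (Fin n))
    (βhat : Ω → EuclideanSpace ℝ (Fin p)) (hmeas : AEMeasurable βhat P)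
    (hβhat : ∀ᵐ ω ∂P, Slope.IsSlopeSolution X (Slope.weights n p A σ) (f + ξ ω) (βhat ω)) :
    (∀ β : EuclideanSpace ℝ (Fin p), Slope.l0 β ≤ s →
      Integrable (fun ω => 1 / 2 * Slope.starNorm (Slope.weights n p A σ) (βhat ω - β)
        + Slope.empNorm (Slope.predict X (βhat ω) - f) ^ 2) P ∧
      ∫ ω, (1 / 2 * Slope.starNorm (Slope.weights n p A σ) (βhat ω - β)
          + Slope.empNorm (Slope.predict X (βhat ω) - f) ^ 2) ∂P
        ≤ Slope.empNorm (Slope.predict X β - f) ^ 2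
          + 49 * Slope.sumSq (Slope.weights n p A σ) s / 16
            * (1 / Slope.wreConst X (Slope.weights n p A σ) s 7 ^ 2
              + 1 / (2 * Real.log (2 * (p : ℝ))))) ∧
    (∀ βstar : EuclideanSpace ℝ (Fin p), Slope.l0 βstar ≤ s → f = Slope.predict X βstar →
      Integrable (fun ω => ‖βhat ω - βstar‖ ^ 2) P ∧
      ∫ ω, ‖βhat ω - βstar‖ ^ 2 ∂P
        ≤ 9 * Slope.sumSq (Slope.weights n p A σ) s / 4
          * (1 / Slope.wreConst X (Slope.weights n p A σ) s 3 ^ 4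
            + 1 / Real.log (2 * (p : ℝ)) ^ 2)) := by

  have hA0 : 0 < A := by linarith [Real.sqrt_nonneg 2]
  have hp : 1 ≤ p := hs.trans hsp
  have hn' : (0 : ℝ) < n := by exact_mod_cast hn
  have hp' : (1 : ℝ) ≤ p := by exact_mod_cast hp
  have hl := Slope.antitone_weights (n := n) (p := p) hA0.le hσ.le
  have hl0 := Slope.weights_nonneg (n := n) (p := p) hA0.le hσ.le
  obtain ⟨v, hv, hi1, hm1, hi2, hm2⟩ :=
    Slope.exists_noise_displacement hn hp X hσ hX.1 hξ
  set L := Real.log (2 * (p : ℝ)) with hL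
  have hL0 : 0 < L := Real.log_pos (by linarith)
  -- the largest weight, `λ₁`
  set c := Slope.weights n p A σ ⟨0, hp⟩ with hc
  have hc2 : c ^ 2 = A ^ 2 * σ ^ 2 * (L / n) := by
    rw [hc, Slope.sq_weights]
    simp [hL]
  have hcsum : c ^ 2 ≤ Slope.sumSq (Slope.weights n p A σ) s := by
    refine Finset.single_le_sum (f := fun j => Slope.weights n p A σ j ^ 2)
      (fun _ _ => sq_nonneg _) ?_
    exact Finset.mem_filter.2 ⟨Finset.mem_univ _, hs⟩
  have hcpos : 0 < c := by
    refine lt_of_le_of_ne (hl0 _) fun h => ?_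
    have : 0 < c ^ 2 := by rw [hc2]; positivity
    rw [← h] at this
    simp at this
  have hpc : Continuous (Slope.predict X) := by
    unfold Slope.predict
    exact LinearMap.continuous_of_finiteDimensional _
  have hec : Continuous (Slope.empNorm (n := n)) := by
    unfold Slope.empNorm
    fun_prop
  constructor
  · intro β hβ
    have hcont : Continuous fun b : EuclideanSpace ℝ (Fin p) =>
        1 / 2 * Slope.starNorm (Slope.weights n p A σ) (b - β)
          + Slope.empNorm (Slope.predict X b - f) ^ 2 := by
      have := Slope.continuous_starNorm hl
      fun_prop
    obtain ⟨h1, h2⟩ := Slope.integrable_and_integral_le_of_ae_le (P := P)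
      (hcont.measurable.comp_aemeasurable hmeas).aestronglyMeasurable
      (fun ω => add_nonneg (mul_nonneg (by norm_num) (Slope.starNorm_nonneg hl0 _)) (sq_nonneg _))
      hi1 (b := 49 / 16 * (A ^ 2 / (2 * n))) (by positivity) hm1 (by
        filter_upwards [hβhat] with ω hω
        have := Slope.prediction_error_le hn X hσ hA hX.2 (hv ω) hω hβ
        rw [← mul_assoc (49 / 16 : ℝ) (A ^ 2 / (2 * n))] at this
        exact this)
    refine ⟨h1, h2.trans ?_⟩
    have h3 : 49 / 16 * (A ^ 2 / (2 * n)) * σ ^ 2 = 49 / 16 * (c ^ 2 * (1 / (2 * L))) := by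
      rw [hc2]
      field_simp
    have h4 : c ^ 2 * (1 / (2 * L))
        ≤ Slope.sumSq (Slope.weights n p A σ) s * (1 / (2 * L)) :=
      mul_le_mul_of_nonneg_right hcsum (by positivity)
    have h5 : Slope.empNorm (Slope.predict X β - f) ^ 2
          + 49 * Slope.sumSq (Slope.weights n p A σ) s / 16
            * (1 / Slope.wreConst X (Slope.weights n p A σ) s 7 ^ 2 + 1 / (2 * L))
        = Slope.empNorm (Slope.predict X β - f) ^ 2
          + 49 / 16 * (Slope.sumSq (Slope.weights n p A σ) s
            / Slope.wreConst X (Slope.weights n p A σ) s 7 ^ 2)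
          + 49 / 16 * (Slope.sumSq (Slope.weights n p A σ) s * (1 / (2 * L))) := by ring
    rw [h3, h5]
    linarith
  · intro βstar hβ hf
    subst hf
    have hcS : ∀ u, c * ‖u‖ ≤ Slope.starNorm (Slope.weights n p A σ) u := by
      refine Slope.mul_norm_le_starNorm hl hl0 fun j => ?_
      rw [hc2, Slope.sq_weights]
      have h1 := Slope.log_two_mul_le j
      have h2 := div_le_div_of_nonneg_right h1 hn'.le
      have h3 := mul_le_mul_of_nonneg_left h2 (by positivity : 0 ≤ A ^ 2 * σ ^ 2)
      refine h3.trans (le_of_eq ?_)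
      ring
    have hcont : Continuous fun b : EuclideanSpace ℝ (Fin p) => ‖b - βstar‖ ^ 2 := by fun_prop
    obtain ⟨h1, h2⟩ := Slope.integrable_and_integral_le_of_ae_le (P := P)
      (hcont.measurable.comp_aemeasurable hmeas).aestronglyMeasurable
      (fun ω => sq_nonneg _)
      hi2
      (a := 9 / 4 * (Slope.sumSq (Slope.weights n p A σ) s
        / Slope.wreConst X (Slope.weights n p A σ) s 3 ^ 4))
      (b := 9 / 4 * (A ^ 4 / (4 * n ^ 2) / c ^ 2)) (by positivity) hm2 (by
        filter_upwards [hβhat] with ω hω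
        have := Slope.estimation_error_le hn X hσ hA hX.2 (hv ω) hω hβ hcpos hcS
        refine this.trans (le_of_eq ?_)
        ring)
    refine ⟨h1, h2.trans ?_⟩
    have h3 : 9 / 4 * (A ^ 4 / (4 * n ^ 2) / c ^ 2) * (4 * σ ^ 4)
        = 9 / 4 * (c ^ 2 * (1 / L ^ 2)) := by
      have h4 : A ^ 4 * σ ^ 4 = (c ^ 2 * n / L) ^ 2 := by
        rw [hc2]
        field_simp
      calc 9 / 4 * (A ^ 4 / (4 * n ^ 2) / c ^ 2) * (4 * σ ^ 4)
          = 9 / 4 * ((A ^ 4 * σ ^ 4) / n ^ 2 / c ^ 2) := by ring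
        _ = _ := by
            rw [h4]
            field_simp
    have h4 : c ^ 2 * (1 / L ^ 2) ≤ Slope.sumSq (Slope.weights n p A σ) s * (1 / L ^ 2) :=
      mul_le_mul_of_nonneg_right hcsum (by positivity)
    have h5 : 9 * Slope.sumSq (Slope.weights n p A σ) s / 4
          * (1 / Slope.wreConst X (Slope.weights n p A σ) s 3 ^ 4 + 1 / L ^ 2)
        = 9 / 4 * (Slope.sumSq (Slope.weights n p A σ) s
            / Slope.wreConst X (Slope.weights n p A σ) s 3 ^ 4)
          + 9 / 4 * (Slope.sumSq (Slope.weights n p A σ) s * (1 / L ^ 2)) := by ring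
    rw [h3, h5]
    linarith
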